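/- Let $G$ be a connected semisimple real algebraic group with Lie algebra $\mathfrak g$ and identity $e$. Fix a Cartan involution of $\mathfrak g$ with decomposition $\mathfrak g=\mathfrak k\oplus\mathfrak p$, the maximal compact subgroup $K<G$ with Lie algebra $\mathfrak k$, a maximal abelian subalgebra $\mathfrak a\subset\mathfrak p$ and a closed positive Weyl chamber $\mathfrak a^+\subset\mathfrak a$; let $\Phi^+$ be the set of positive restricted roots. Put $A=\exp\mathfrak a$, $M=C_K(A)$, \[N=\{n\in G:\lim_{t\to\infty}\exp(-tw)\,n\exp(tw)=e\ \text{ for all } w\in\operatorname{int}\mathfrak a^+\},\] \[N^+=\{h\in G:\lim_{t\to\infty}\exp(tw)\,h\exp(-tw)=e\ \text{ for all } w\in\operatorname{int}\mathfrak a^+\},\] with Lie algebras $\mathfrak n,\mathfrak n^+$. Let $d$ be the distance of a left $G$-invariant and right $K$-invariant Riemannian metric on $G$, and fix $\mathrm{Ad}_M$-invariant norms on $\mathfrak n$ and $\mathfrak n^+$. For $\varepsilon>0$ let $A_\varepsilon=\{a\in A:d(e,a)<\varepsilon\}$, $M_\varepsilon=\{m\in M:d(e,m)<\varepsilon\}$,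 $N_\varepsilon=\{\exp x:x\in\mathfrak n,\|x\|<\varepsilon\}$, $N^+_\varepsilon=\{\exp x:x\in\mathfrak n^+,\|x\|<\varepsilon\}$, and define the $\varepsilon$-flow box at $g_0\in G$ by \[\mathfrak B(g_0,\varepsilon)=g_0\,(N^+_\varepsilon N\cap N_\varepsilon N^+AM)\,M_\varepsilon A_\varepsilon .\] There exists $T_0>0$, depending only on $G$, such that, for all choices as above, there are constants $\varepsilon_0>0$ and $C>0$ for which the following holds. Let $0<\varepsilon<\varepsilon_0$ and $g_0\in G$, and suppose that $g_1,g_2\in\mathfrak B(g_0,\varepsilon)$, $\gamma\in G$, $\tilde a\in A$ and $\tilde m\in M$ satisfy \[g_1\tilde a\tilde m=\gamma g_2\qquad\text{and}\qquad T:=\min_{\alpha\in\Phi^+}\alpha(\log\tilde a)\ge T_0 .\] Then there exist $g\in\mathfrak B(g_0,\varepsilon+C\varepsilon e^{-T})$, $a\in A$ and $m\in M$ such that \[\gamma=g\,a\,m\,g^{-1},\qquad d(a,\tilde a)\le C\varepsilon,\qquad d(m,\tilde m)\le C\varepsilon .\] -/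

import Mathlib

open Filter Topology Matrix
open scoped Pointwise ENNReal

noncomputable section

attribute [local instance 100] LieRing.ofAssociativeRing

/-! ## The exponential map and Lie algebras of closed linear groups -/

/-- Real square matrices of size `n`. -/
abbrev RMat (n : ℕ) : Type := Matrix (Fin n) (Fin n) ℝ

/-- The matrix exponential as a map `M_n(ℝ) → GL_n(ℝ)`. -/
def expGL {n : ℕ} (X : RMat n) : GL (Fin n) ℝ where
  val := NormedSpace.exp X
  inv := NormedSpace.exp (-X)
  val_inv := by
    rw [← Matrix.exp_add_of_commute _ _ (Commute.neg_right (Commute.refl X))]; simp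
  inv_val := by
    rw [← Matrix.exp_add_of_commute _ _ (Commute.neg_left (Commute.refl X))]; simp

section ExpFacts

open scoped Matrix.Norms.Operator

variable {n : ℕ}

theorem expGL_val (X : RMat n) : (expGL X : RMat n) = NormedSpace.exp X := rfl

theorem expGL_zero : expGL (0 : RMat n) = 1 := by
  apply Units.ext; simp [expGL_val]

theorem continuous_expGL : Continuous (expGL : RMat n → GL (Fin n) ℝ) := by
  rw [Units.continuous_iff]
  have h : Continuous (NormedSpace.exp : RMat n → RMat n) := NormedSpace.exp_continuous
  exact ⟨h, h.comp continuous_neg⟩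

theorem expGL_nsmul (k : ℕ) (X : RMat n) : expGL (k • X) = expGL X ^ k := by
  apply Units.ext
  simp only [expGL_val, Units.val_pow_eq_pow_val]
  exact Matrix.exp_nsmul k X

theorem expGL_conj (g : GL (Fin n) ℝ) (X : RMat n) :
    expGL ((g : RMat n) * X * ((g⁻¹ : GL (Fin n) ℝ) : RMat n)) = g * expGL X * g⁻¹ := by
  apply Units.ext
  simp only [expGL_val, Units.val_mul]
  exact Matrix.exp_units_conj g X

theorem hasDerivAt_exp_smul_zero (X : RMat n) :
    HasDerivAt (fun s : ℝ => NormedSpace.exp (s • X)) X 0 := by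
  have h := hasDerivAt_exp_smul_const (𝕂 := ℝ) X (0 : ℝ)
  rw [zero_smul, NormedSpace.exp_zero, one_mul] at h
  exact h

/-- The Lie product formula, in the form of a convergence in `GL_n(ℝ)`. -/
theorem tendsto_lie_product (X Y : RMat n) (t : ℝ) :
    Tendsto (fun k : ℕ => (expGL ((t / k) • X) * expGL ((t / k) • Y)) ^ k) atTop
      (𝓝 (expGL (t • (X + Y)))) := by
  have hs : HasStrictFDerivAt (NormedSpace.exp : RMat n → RMat n)
      ((ContinuousLinearEquiv.refl ℝ (RMat n) : RMat n ≃L[ℝ] RMat n) : RMat n →L[ℝ] RMat n) 0 :=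
    hasStrictFDerivAt_exp_zero
  set L : RMat n → RMat n := hs.localInverse _ _ _ with hL
  have hLd : HasStrictFDerivAt L
      (((ContinuousLinearEquiv.refl ℝ (RMat n)).symm : RMat n ≃L[ℝ] RMat n) :
        RMat n →L[ℝ] RMat n) (NormedSpace.exp 0) := hs.to_localInverse
  have hLr : ∀ᶠ y in 𝓝 (NormedSpace.exp (0 : RMat n)), NormedSpace.exp (L y) = y :=
    hs.eventually_right_inverse
  have hL0 : L 1 = 0 := by
    have := hs.localInverse_apply_image
    simpa using this
  rw [NormedSpace.exp_zero] at hLd hLr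
  set f : ℝ → RMat n := fun s => NormedSpace.exp (s • X) * NormedSpace.exp (s • Y) with hf
  have hf0 : f 0 = 1 := by simp [hf]
  have hfd : HasDerivAt f (X + Y) 0 := by
    have := (hasDerivAt_exp_smul_zero X).mul (hasDerivAt_exp_smul_zero Y)
    rw [zero_smul, zero_smul, NormedSpace.exp_zero, one_mul, mul_one] at this
    exact this
  have hLf : HasDerivAt (fun s => L (f s)) (X + Y) 0 := by
    have h1 : HasFDerivAt L
      (((ContinuousLinearEquiv.refl ℝ (RMat n)).symm : RMat n ≃L[ℝ] RMat n) :
        RMat n →L[ℝ] RMat n) (f 0) := by rw [hf0]; exact hLd.hasFDerivAt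
    have := h1.comp_hasDerivAt (0 : ℝ) hfd
    exact this
  have hdiv : Tendsto (fun k : ℕ => t / (k : ℝ)) atTop (𝓝 0) :=
    tendsto_const_div_atTop_nhds_zero_nat t
  have hlim : Tendsto (fun k : ℕ => (k : ℕ) • L (f (t / k))) atTop (𝓝 (t • (X + Y))) := by
    by_cases ht : t = 0
    · subst ht; simp [hf0, hL0]
    have hne : Tendsto (fun k : ℕ => t / (k : ℝ)) atTop (𝓝[≠] 0) := by
      refine tendsto_nhdsWithin_iff.2 ⟨hdiv, ?_⟩
      filter_upwards [eventually_gt_atTop 0] with k hk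
      have : (k : ℝ) ≠ 0 := by positivity
      exact div_ne_zero ht this
    have h2 := (hasDerivAt_iff_tendsto_slope.1 hLf).comp hne
    refine (h2.const_smul t).congr' ?_
    filter_upwards [eventually_gt_atTop 0] with k hk
    have hk' : (k : ℝ) ≠ 0 := by positivity
    simp only [Function.comp_apply, slope_def_module, hf0, hL0, sub_zero]
    rw [smul_smul, ← Nat.cast_smul_eq_nsmul ℝ]
    congr 1
    field_simp
  have h3 := (continuous_expGL.tendsto _).comp hlim
  refine h3.congr' ?_
  have hfc : Tendsto (fun k : ℕ => f (t / k)) atTop (𝓝 1) := by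
    have := hfd.continuousAt.tendsto.comp hdiv
    rwa [hf0] at this
  filter_upwards [hfc.eventually hLr] with k hk
  simp only [Function.comp_apply]
  rw [expGL_nsmul]
  congr 1
  apply Units.ext
  rw [expGL_val, hk]
  rfl

end ExpFacts

/-- The Lie algebra `{X : exp(tX) ∈ H for all t ∈ ℝ}` of a closed subgroup `H` of `GL_n(ℝ)`, as a
real vector space. -/
def lieSubspace {n : ℕ} (H : ClosedSubgroup (GL (Fin n) ℝ)) : Submodule ℝ (RMat n) where
  carrier := {X | ∀ t : ℝ, expGL (t • X) ∈ H}
  zero_mem' := fun t => by rw [smul_zero, expGL_zero]; exact one_mem H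
  add_mem' := fun {X Y} hX hY t =>
    H.isClosed'.mem_of_tendsto (tendsto_lie_product X Y t)
      (Eventually.of_forall fun _ => pow_mem (mul_mem (hX _) (hY _)) _)
  smul_mem' := fun c X hX t => by rw [smul_smul]; exact hX _

theorem lieSubspace_conj {n : ℕ} (H : ClosedSubgroup (GL (Fin n) ℝ)) {g : GL (Fin n) ℝ}
    (hg : g ∈ H) {X : RMat n} (hX : X ∈ lieSubspace H) :
    (g : RMat n) * X * ((g⁻¹ : GL (Fin n) ℝ) : RMat n) ∈ lieSubspace H := fun t => by
  have h : t • ((g : RMat n) * X * ((g⁻¹ : GL (Fin n) ℝ) : RMat n)) =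
      (g : RMat n) * (t • X) * ((g⁻¹ : GL (Fin n) ℝ) : RMat n) := by
    rw [Matrix.mul_smul, Matrix.smul_mul]
  rw [h, expGL_conj]
  exact mul_mem (mul_mem hg (hX t)) (inv_mem hg)

section BracketFact

open scoped Matrix.Norms.Operator

theorem lieSubspace_lie {n : ℕ} (H : ClosedSubgroup (GL (Fin n) ℝ)) {X Y : RMat n}
    (hX : X ∈ lieSubspace H) (hY : Y ∈ lieSubspace H) : ⁅X, Y⁆ ∈ lieSubspace H := by
  have hcl : IsClosed (lieSubspace H : Set (RMat n)) :=
    Submodule.closed_of_finiteDimensional _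
  have hd : HasDerivAt (fun s : ℝ => NormedSpace.exp (s • X) * Y * NormedSpace.exp (s • (-X)))
      ⁅X, Y⁆ 0 := by
    have := ((hasDerivAt_exp_smul_zero X).mul_const Y).mul (hasDerivAt_exp_smul_zero (-X))
    rw [zero_smul, zero_smul, NormedSpace.exp_zero, one_mul, mul_one, mul_neg,
      ← sub_eq_add_neg] at this
    exact this
  have hmem : ∀ s : ℝ, NormedSpace.exp (s • X) * Y * NormedSpace.exp (s • (-X)) ∈
      lieSubspace H := fun s => by
    have := lieSubspace_conj H (hX s) hY
    rw [smul_neg]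
    exact this
  refine hcl.mem_of_tendsto (hasDerivAt_iff_tendsto_slope.1 hd) (Eventually.of_forall fun s => ?_)
  rw [slope_def_module]
  exact (lieSubspace H).smul_mem _ ((lieSubspace H).sub_mem (hmem _) (hmem _))

end BracketFact

/-- The Lie algebra of a closed subgroup `H` of `GL_n(ℝ)`. -/
def lieAlg {n : ℕ} (H : ClosedSubgroup (GL (Fin n) ℝ)) : LieSubalgebra ℝ (RMat n) where
  toSubmodule := lieSubspace H
  lie_mem' := fun hX hY => lieSubspace_lie H hX hY

theorem mem_lieAlg {n : ℕ} (H : ClosedSubgroup (GL (Fin n) ℝ)) (X : RMat n) :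
    X ∈ lieAlg H ↔ ∀ t : ℝ, expGL (t • X) ∈ H := Iff.rfl

/-! ## Real algebraic groups -/

/-- A subset of `GL_n(ℝ)` is Zariski closed if it is the set of common zeros in `GL_n(ℝ)` of a
family of real polynomials in the matrix entries. -/
def IsZariskiClosed {n : ℕ} (S : Set (GL (Fin n) ℝ)) : Prop :=
  ∃ I : Set (MvPolynomial (Fin n × Fin n) ℝ), ∀ g : GL (Fin n) ℝ,
    g ∈ S ↔ ∀ p ∈ I, MvPolynomial.eval (fun ij => (g : RMat n) ij.1 ij.2) p = 0

/-- A Zariski closed subset is Zariski connected if it is not the disjoint union of two nonempty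
Zariski closed subsets. -/
def IsZariskiConnected {n : ℕ} (S : Set (GL (Fin n) ℝ)) : Prop :=
  ∀ S₁ ⊆ S, IsZariskiClosed S₁ → IsZariskiClosed (S \ S₁) → S₁ = ∅ ∨ S₁ = S

/-- `G` is a connected semisimple real algebraic group: its Lie algebra is semisimple, and `G` is
either the group of real points `H` of a Zariski connected linear algebraic group, or the identity
component of such an `H`, or any group in between (that is, an open subgroup of `H`). -/
structure IsConnectedSemisimpleRealAlgebraic {n : ℕ} (G : ClosedSubgroup (GL (Fin n) ℝ)) :
    Prop where
  semisimple : LieAlgebra.HasTrivialRadical ℝ (lieAlg G)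
  algebraic : ∃ H : Subgroup (GL (Fin n) ℝ),
    IsZariskiClosed (H : Set (GL (Fin n) ℝ)) ∧ IsZariskiConnected (H : Set (GL (Fin n) ℝ)) ∧
    ∃ U : Set (GL (Fin n) ℝ), IsOpen U ∧ (G : Set (GL (Fin n) ℝ)) = U ∩ H

/-! ## Restricted roots and Weyl chambers -/

section Roots

variable {L : Type*} [LieRing L] [LieAlgebra ℝ L]

/-- `α` is a restricted root of `𝔞`: it is a nonzero linear form whose root space
`{X : [w, X] = α(w) X for all w ∈ 𝔞}` is nonzero. -/
def IsRestrictedRoot (𝔞 : Submodule ℝ L) (α : Module.Dual ℝ 𝔞) : Prop :=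
  α ≠ 0 ∧ ∃ X : L, X ≠ 0 ∧ ∀ w : 𝔞, ⁅(w : L), X⁆ = α w • X

/-- `C` is a closed Weyl chamber: the closed cone on which all the restricted roots that are
positive at some given regular vector `w₀` are nonnegative. -/
def IsWeylChamber (𝔞 : Submodule ℝ L) (C : Set 𝔞) : Prop :=
  ∃ w₀ : 𝔞, (∀ α, IsRestrictedRoot 𝔞 α → α w₀ ≠ 0) ∧
    C = {w | ∀ α, IsRestrictedRoot 𝔞 α → 0 < α w₀ → 0 ≤ α w}

end Roots

/-! ## Horospherical subgroups -/

section Horospherical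

open scoped Matrix.Norms.Operator

theorem tendsto_GL_one_iff {n : ℕ} (u : ℝ → GL (Fin n) ℝ) :
    Tendsto u atTop (𝓝 1) ↔ Tendsto (fun t => (u t : RMat n) - 1) atTop (𝓝 0) := by
  have h1 : Tendsto u atTop (𝓝 1) ↔
      Tendsto (fun t => (u t : RMat n)) atTop (𝓝 ((1 : GL (Fin n) ℝ) : RMat n)) :=
    (Units.isOpenEmbedding_val (R := RMat n)).isEmbedding.tendsto_nhds_iff
  have h2 := tendsto_sub_nhds_zero_iff (l := atTop) (u := fun t => (u t : RMat n)) (x := 1)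
  exact h1.trans h2.symm

/-- The matrices `Y` such that `exp(tX) Y exp(tX)⁻¹ → 0` as `t → ∞`, for every `X ∈ S`. -/
def contractedSubspace {n : ℕ} (S : Set (RMat n)) : Submodule ℝ (RMat n) where
  carrier := {Y | ∀ X ∈ S, Tendsto (fun t : ℝ => (expGL (t • X) : RMat n) * Y *
    (((expGL (t • X))⁻¹ : GL (Fin n) ℝ) : RMat n)) atTop (𝓝 0)}
  zero_mem' := fun X _ => by simp
  add_mem' := fun {Y Z} hY hZ X hX => by
    have h := (hY X hX).add (hZ X hX)
    rw [add_zero] at h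
    refine h.congr fun t => ?_
    rw [mul_add, add_mul]
  smul_mem' := fun c Y hY X hX => by
    have h := (hY X hX).const_smul c
    rw [smul_zero] at h
    refine h.congr fun t => ?_
    rw [Matrix.mul_smul, Matrix.smul_mul]

theorem tendsto_conj_iff {n : ℕ} (S : Set (RMat n)) (g : GL (Fin n) ℝ) :
    (∀ X ∈ S, Tendsto (fun t : ℝ => expGL (t • X) * g * (expGL (t • X))⁻¹) atTop (𝓝 1)) ↔
      (g : RMat n) - 1 ∈ contractedSubspace S := by
  refine forall₂_congr fun X _ => ?_
  rw [tendsto_GL_one_iff]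
  refine tendsto_congr fun t => ?_
  rw [mul_sub, sub_mul, mul_one, Units.mul_inv, Units.val_mul, Units.val_mul]

/-- The closed subgroup of all `g ∈ G` with `exp(tX) g exp(tX)⁻¹ → e` as `t → ∞`, for every
`X ∈ S`. -/
def horospherical {n : ℕ} (G : ClosedSubgroup (GL (Fin n) ℝ)) (S : Set (RMat n)) :
    ClosedSubgroup (GL (Fin n) ℝ) where
  carrier := {g | g ∈ G ∧ ∀ X ∈ S,
    Tendsto (fun t : ℝ => expGL (t • X) * g * (expGL (t • X))⁻¹) atTop (𝓝 1)}
  one_mem' := ⟨one_mem G, fun X _ => by simp⟩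
  mul_mem' := fun {g h} hg hh => ⟨mul_mem hg.1 hh.1, fun X hX => by
    have h1 := (hg.2 X hX).mul (hh.2 X hX)
    rw [mul_one] at h1
    refine h1.congr fun t => ?_
    group⟩
  inv_mem' := fun {g} hg => ⟨inv_mem hg.1, fun X hX => by
    have h1 := (hg.2 X hX).inv
    rw [inv_one] at h1
    refine h1.congr fun t => ?_
    group⟩
  isClosed' := by
    have hV : IsClosed (contractedSubspace S : Set (RMat n)) :=
      Submodule.closed_of_finiteDimensional _
    have hc : Continuous fun g : GL (Fin n) ℝ => (g : RMat n) - 1 :=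
      Units.continuous_val.sub continuous_const
    have h := G.isClosed'.inter (hV.preimage hc)
    convert h using 1
    ext g
    exact and_congr Iff.rfl (tendsto_conj_iff S g)

end Horospherical

/-! ## The structure data of `G` -/

/-- The choices attached to a semisimple real algebraic group `G` with Lie algebra `𝔤`: a Cartan
involution `θ` with its decomposition `𝔤 = 𝔨 ⊕ 𝔭`, the maximal compact subgroup `K` with Lie
algebra `𝔨`, a maximal abelian subalgebra `𝔞` of `𝔭` and a closed positive Weyl chamber in `𝔞`. -/
structure CartanData {n : ℕ} (G : ClosedSubgroup (GL (Fin n) ℝ)) where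
  θ : lieAlg G ≃ₗ⁅ℝ⁆ lieAlg G
  θ_invol : ∀ X, θ (θ X) = X
  θ_pos : ∀ X, X ≠ 0 → 0 < -(killingForm ℝ (lieAlg G) X (θ X))
  K : ClosedSubgroup (GL (Fin n) ℝ)
  K_le : ∀ k ∈ K, k ∈ G
  K_compact : IsCompact (K : Set (GL (Fin n) ℝ))
  K_maximal : ∀ K' : Subgroup (GL (Fin n) ℝ), (∀ k ∈ K, k ∈ K') → (∀ k ∈ K', k ∈ G) →
    IsCompact (K' : Set (GL (Fin n) ℝ)) → ∀ k ∈ K', k ∈ K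
  K_lieAlg : ∀ X : lieAlg G, (X : RMat n) ∈ lieAlg K ↔ θ X = X
  𝔞 : Submodule ℝ (lieAlg G)
  𝔞_le : ∀ X ∈ 𝔞, θ X = -X
  𝔞_abelian : ∀ X ∈ 𝔞, ∀ Y ∈ 𝔞, ⁅X, Y⁆ = 0
  𝔞_maximal : ∀ X, θ X = -X → (∀ Y ∈ 𝔞, ⁅X, Y⁆ = 0) → X ∈ 𝔞
  chamber : Set 𝔞
  chamber_isWeylChamber : IsWeylChamber 𝔞 chamber

namespace CartanData

variable {n : ℕ} {G : ClosedSubgroup (GL (Fin n) ℝ)} (D : CartanData G)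

/-- The positive restricted roots: those that are nonnegative on the positive Weyl chamber. -/
def IsPositiveRoot (α : Module.Dual ℝ D.𝔞) : Prop :=
  IsRestrictedRoot D.𝔞 α ∧ ∀ w ∈ D.chamber, 0 ≤ α w

/-- The inclusion of `𝔞` into the space of matrices. -/
def toMat (w : D.𝔞) : RMat n := ((w : lieAlg G) : RMat n)

/-- The exponential map on `𝔞`. -/
def expA (w : D.𝔞) : GL (Fin n) ℝ := expGL (D.toMat w)

/-- `A = exp 𝔞`. -/
def A : Set (GL (Fin n) ℝ) := Set.range D.expA

/-- `M = C_K(A)`. -/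
def M : Set (GL (Fin n) ℝ) := {k | k ∈ D.K ∧ ∀ a ∈ D.A, k * a = a * k}

/-- `N = N⁻`: the `g ∈ G` with `exp(-tw) g exp(tw) → e` for all `w` in the interior of the positive
Weyl chamber. -/
def N : ClosedSubgroup (GL (Fin n) ℝ) :=
  horospherical G {X | ∃ w ∈ interior D.chamber, X = -D.toMat w}

/-- `N⁺`: the `g ∈ G` with `exp(tw) g exp(-tw) → e` for all `w` in the interior of the positive
Weyl chamber. -/
def Np : ClosedSubgroup (GL (Fin n) ℝ) :=
  horospherical G {X | ∃ w ∈ interior D.chamber, X = D.toMat w}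

end CartanData

/-! ## Metrics and flow boxes -/

/-- A continuously differentiable curve `c : [0, 1] → G` with velocity `c'(t) = c(t) v(t)`, where
`v(t) ∈ 𝔤` is the velocity translated to the identity. -/
structure IsC1Curve {n : ℕ} (G : ClosedSubgroup (GL (Fin n) ℝ)) (c : ℝ → GL (Fin n) ℝ)
    (v : ℝ → lieAlg G) : Prop where
  mem : ∀ t ∈ Set.Icc (0 : ℝ) 1, c t ∈ G
  continuousOn : ContinuousOn v (Set.Icc 0 1)
  hasDeriv : ∀ t ∈ Set.Icc (0 : ℝ) 1, ∀ i j : Fin n,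
    HasDerivWithinAt (fun s => (c s : RMat n) i j) (((c t : RMat n) * (v t : RMat n)) i j)
      (Set.Icc 0 1) t

/-- The metric choices: a left `G`-invariant and right `K`-invariant Riemannian metric on `G`,
that is, an `Ad_K`-invariant inner product on `𝔤`; and `Ad_M`-invariant norms on the Lie algebras
`𝔫` and `𝔫⁺` of `N` and `N⁺`. -/
structure MetricData {n : ℕ} {G : ClosedSubgroup (GL (Fin n) ℝ)} (D : CartanData G) where
  ip : LinearMap.BilinForm ℝ (lieAlg G)
  ip_symm : ∀ X Y, ip X Y = ip Y X
  ip_pos : ∀ X, X ≠ 0 → 0 < ip X X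
  ip_inv : ∀ k ∈ D.K, ∀ X X' Y Y' : lieAlg G,
    (X' : RMat n) = (k : RMat n) * (X : RMat n) * ((k⁻¹ : GL (Fin n) ℝ) : RMat n) →
    (Y' : RMat n) = (k : RMat n) * (Y : RMat n) * ((k⁻¹ : GL (Fin n) ℝ) : RMat n) →
    ip X' Y' = ip X Y
  normN : Seminorm ℝ (lieAlg D.N)
  normN_pos : ∀ x, x ≠ 0 → 0 < normN x
  normN_inv : ∀ m ∈ D.M, ∀ x x' : lieAlg D.N,
    (x' : RMat n) = (m : RMat n) * (x : RMat n) * ((m⁻¹ : GL (Fin n) ℝ) : RMat n) →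
    normN x' = normN x
  normNp : Seminorm ℝ (lieAlg D.Np)
  normNp_pos : ∀ x, x ≠ 0 → 0 < normNp x
  normNp_inv : ∀ m ∈ D.M, ∀ x x' : lieAlg D.Np,
    (x' : RMat n) = (m : RMat n) * (x : RMat n) * ((m⁻¹ : GL (Fin n) ℝ) : RMat n) →
    normNp x' = normNp x

namespace MetricData

variable {n : ℕ} {G : ClosedSubgroup (GL (Fin n) ℝ)} {D : CartanData G} (R : MetricData D)

/-- The Riemannian distance on `G`: the infimum of the lengths of the `C¹` curves in `G` from `x`
to `y` (it is `∞` if there is no such curve). -/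
def riemDist (x y : GL (Fin n) ℝ) : ℝ≥0∞ :=
  ⨅ (c : ℝ → GL (Fin n) ℝ) (v : ℝ → lieAlg G) (_ : IsC1Curve G c v) (_ : c 0 = x) (_ : c 1 = y),
    ENNReal.ofReal (∫ t in (0 : ℝ)..1, Real.sqrt (R.ip (v t) (v t)))

/-- `A_ε = A ∩ G_ε`. -/
def Aball (ε : ℝ) : Set (GL (Fin n) ℝ) := {a | a ∈ D.A ∧ R.riemDist 1 a < ENNReal.ofReal ε}

/-- `M_ε = M ∩ G_ε`. -/
def Mball (ε : ℝ) : Set (GL (Fin n) ℝ) := {m | m ∈ D.M ∧ R.riemDist 1 m < ENNReal.ofReal ε}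

/-- `N_ε = {exp x : x ∈ 𝔫, ‖x‖ < ε}`. -/
def Nball (ε : ℝ) : Set (GL (Fin n) ℝ) :=
  {g | ∃ x : lieAlg D.N, R.normN x < ε ∧ g = expGL (x : RMat n)}

/-- `N⁺_ε = {exp x : x ∈ 𝔫⁺, ‖x‖ < ε}`. -/
def Npball (ε : ℝ) : Set (GL (Fin n) ℝ) :=
  {g | ∃ x : lieAlg D.Np, R.normNp x < ε ∧ g = expGL (x : RMat n)}

/-- The `ε`-flow box `g₀ (N⁺_ε N ∩ N_ε N⁺ A M) M_ε A_ε` at `g₀`. -/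
def flowBox (g₀ : GL (Fin n) ℝ) (ε : ℝ) : Set (GL (Fin n) ℝ) :=
  {g₀} * ((R.Npball ε * (D.N : Set (GL (Fin n) ℝ))) ∩
    (R.Nball ε * (D.Np : Set (GL (Fin n) ℝ)) * D.A * D.M)) * R.Mball ε * R.Aball ε

end MetricData

end

/-! Write `b = ã m̃`, `σ = Ad b` and `k = g₂⁻¹ g₁`. Then `γ = g₂ (k b) g₂⁻¹`, and `k` is
`O(ε)`-close to `e`. If `k = h c (b h b⁻¹)⁻¹` with `h ∈ N⁺N` and `c ∈ AM`, then `k b = h (c b) h⁻¹`,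
so `g₂ h` conjugates `c b ∈ AM` to `γ`.

This twisted equation is solvable because `σ` contracts `𝔫⁺` and expands `𝔫` at rate `e^T`, so `1 -
σ` is invertible on `𝔫⁺ ⊕ 𝔫` by a Neumann series, uniformly in `b`. With `h = exp X exp S` the
equation reads `k = exp X · exp S · c · exp(-σS) · exp(-σX)`. It is a product of exponentials of
linear functions of one unknown `u ∈ 𝔤`, with linear part the identity, and `exists_eq_prod_expGL`
solves it on a neighbourhood of `e` depending only on norm bounds. The outcome is
`exists_twisted_decomp`: `X` is `O(ε)`, while `σX` and `S` are `O(ε e^{-T})`.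

The box containing the conjugator is found by computing `g₂ h` twice. From `g₂ = g₀ exp(y) p` with
`p ∈ N⁺AM`, right multiplication by `exp X exp S` changes the `N` coordinate only through `S`. From
`g₂ h = g₁ (b h b⁻¹) c⁻¹` and `g₁ = g₀ exp(x) q₁`, the `N⁺` coordinate changes only through `σX`.
Both changes are `O(ε e^{-T})`. A leftover factor in `AM` is moved from the conjugator into the
conjugated element, so the `M_ε A_ε` part of `g₁` is kept exactly.

A preliminary point is that the `N` and `N⁺AM` factors in a flow box are not bounded by definition;
`exists_flowBox_bound` bounds them using `N ∩ N⁺AM = {e}`. -/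

noncomputable section

attribute [local instance 100] LieRing.ofAssociativeRing

/-! ### Products of exponentials and a quantitative inverse function theorem -/

section ProductsOfExponentials

variable {𝔸 : Type*} [NormedRing 𝔸] [NormedAlgebra ℝ 𝔸] [CompleteSpace 𝔸]

theorem hasStrictFDerivAt_list_prod_exp {ι : Type*} [Fintype ι] (l : List ι) :
    HasStrictFDerivAt (fun v : ι → 𝔸 => (l.map fun i => NormedSpace.exp (v i)).prod)
      ((l.map fun i => ContinuousLinearMap.proj (R := ℝ) (φ := fun _ : ι => 𝔸) i).sum) 0 := by
  induction l with
  | nil => simpa using hasStrictFDerivAt_const (1 : 𝔸) (0 : ι → 𝔸)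
  | cons i l ih =>
    have he : HasStrictFDerivAt (fun v : ι → 𝔸 => NormedSpace.exp (v i))
        (ContinuousLinearMap.proj (R := ℝ) (φ := fun _ : ι => 𝔸) i) 0 := by
      have h1 : HasStrictFDerivAt (NormedSpace.exp : 𝔸 → 𝔸)
          (ContinuousLinearMap.id ℝ 𝔸)
          (ContinuousLinearMap.proj (R := ℝ) (φ := fun _ : ι => 𝔸) i 0) := hasStrictFDerivAt_exp_zero
      exact h1.comp (0 : ι → 𝔸) (ContinuousLinearMap.hasStrictFDerivAt _)
    have h := he.mul' ih
    simp only [List.map_cons, List.prod_cons, List.sum_cons]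
    refine h.congr_fderiv ?_
    ext1 v
    have h0 : (l.map fun i => NormedSpace.exp ((0 : ι → 𝔸) i)).prod = 1 := by
      apply List.prod_eq_one; simp
    simp [add_comm]

/-- Strict differentiability at `0` compares two arbitrary small arguments. Linear maps can later be
substituted for the `v i` with `δ` depending only on their norms. -/
theorem exists_lipschitz_prod_exp {ι : Type*} [Fintype ι] (l : List ι) {c : ℝ} (hc : 0 < c) :
    ∃ δ : ℝ, 0 < δ ∧ ∀ v v' : ι → 𝔸, ‖v‖ ≤ δ → ‖v'‖ ≤ δ →
      ‖(l.map fun i => NormedSpace.exp (v i)).prod - (l.map fun i => NormedSpace.exp (v' i)).prod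
        - (l.map fun i => v i - v' i).sum‖ ≤ c * ‖v - v'‖ := by
  have h := (hasStrictFDerivAt_list_prod_exp (𝔸 := 𝔸) l).isLittleO.def hc
  obtain ⟨δ, hδ, hb⟩ := Metric.nhds_basis_closedBall.eventually_iff.1 h
  refine ⟨δ, hδ, fun v v' hv hv' => ?_⟩
  have hs : ∀ l : List ι, (l.map fun i => v i - v' i).sum =
      (l.map fun i => ContinuousLinearMap.proj (R := ℝ) (φ := fun _ : ι => 𝔸) i).sum (v - v') := by
    intro l
    induction l with
    | nil => simp
    | cons i l ih => simp [ih]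
  rw [hs]
  exact hb (x := (v, v')) (by
    rw [mem_closedBall_iff_norm]
    simpa [Prod.norm_def] using ⟨hv, hv'⟩)

/-- Every element close to `1` is a product of exponentials `exp (T i u)`, with `u` small uniformly
in the bounded linear maps `T i` of sum `1`. -/
theorem exists_eq_prod_exp (𝔸 : Type*) [NormedRing 𝔸] [NormedAlgebra ℝ 𝔸] [CompleteSpace 𝔸]
    {ι : Type*} [Fintype ι] (l : List ι) (C₁ : ℝ) :
    ∃ δ : ℝ, 0 < δ ∧ ∀ T : ι → 𝔸 →ₗ[ℝ] 𝔸, (∀ i u, ‖T i u‖ ≤ C₁ * ‖u‖) →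
      (∀ u, (l.map fun i => T i u).sum = u) → ∀ k : 𝔸, ‖k - 1‖ ≤ δ →
        ∃ u, ‖u‖ ≤ 2 * ‖k - 1‖ ∧ k = (l.map fun i => NormedSpace.exp (T i u)).prod := by
  set B := max C₁ 1
  have hB : 0 < B := lt_of_lt_of_le one_pos (le_max_right _ _)
  obtain ⟨δ, hδ, h⟩ := exists_lipschitz_prod_exp (𝔸 := 𝔸) l (c := 1 / (2 * B)) (by positivity)
  refine ⟨δ / (2 * B), by positivity, fun T hT hsum k hk => ?_⟩
  set f : 𝔸 → 𝔸 := fun u => (l.map fun i => NormedSpace.exp (T i u)).prod with hf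
  have hTB : ∀ u : 𝔸, ‖fun i => T i u‖ ≤ B * ‖u‖ := fun u =>
    (pi_norm_le_iff_of_nonneg (by positivity)).2 fun i =>
      (hT i u).trans (mul_le_mul_of_nonneg_right (le_max_left _ _) (norm_nonneg _))
  -- On the ball of radius `2‖k - 1‖`, `f` differs from the identity by a `1/2`-Lipschitz map, so
  -- its image contains the ball of radius `(1 - 1/2) · 2‖k - 1‖` about `f 0 = 1`, which reaches
  -- `k`.
  have happ : ApproximatesLinearOn f
      ((ContinuousLinearEquiv.refl ℝ 𝔸 : 𝔸 ≃L[ℝ] 𝔸) : 𝔸 →L[ℝ] 𝔸)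
      (Metric.closedBall 0 (2 * ‖k - 1‖)) (1 / 2) := by
    intro u hu u' hu'
    have hin : ∀ u ∈ Metric.closedBall (0 : 𝔸) (2 * ‖k - 1‖), ‖fun i => T i u‖ ≤ δ := by
      intro u hu
      rw [mem_closedBall_zero_iff] at hu
      calc _ ≤ B * ‖u‖ := hTB u
        _ ≤ B * (2 * (δ / (2 * B))) := by gcongr; linarith
        _ = δ := by field_simp
    have h1 := h _ _ (hin u hu) (hin u' hu')
    have h2 : (l.map fun i => T i u - T i u').sum = u - u' := by
      have := hsum (u - u')
      simpa using this
    rw [h2] at h1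
    have h3 : ‖(fun i => T i u) - fun i => T i u'‖ ≤ B * ‖u - u'‖ := by
      have := hTB (u - u')
      convert this using 2
      ext1 i; simp
    calc _ ≤ 1 / (2 * B) * ‖(fun i => T i u) - fun i => T i u'‖ := h1
      _ ≤ 1 / (2 * B) * (B * ‖u - u'‖) := by gcongr
      _ = _ := by push_cast; field_simp
  have hsurj := happ.surjOn_closedBall_of_nonlinearRightInverse
    (ContinuousLinearEquiv.refl ℝ 𝔸).toNonlinearRightInverse
    (b := 0) (ε := 2 * ‖k - 1‖) (by positivity) subset_rfl
  have hf0 : f 0 = 1 := by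
    simp only [hf, map_zero, NormedSpace.exp_zero]
    apply List.prod_eq_one; simp
  have hnn : ((ContinuousLinearEquiv.refl ℝ 𝔸).toNonlinearRightInverse.nnnorm : ℝ) ≤ 1 :=
    ContinuousLinearMap.norm_id_le
  by_cases hk0 : k = 1
  · exact ⟨0, by simp, by rw [hk0, ← hf0]⟩
  obtain ⟨u, hu, huk⟩ := hsurj (a := k) (by
    rw [mem_closedBall_iff_norm, hf0]
    -- The radius contains the inverse of the norm of the right inverse. The junk value `0⁻¹ = 0`
    -- must be excluded: norm `0` would force `k = 1`.
    rcases eq_or_lt_of_le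
      (NNReal.coe_nonneg (ContinuousLinearEquiv.refl ℝ 𝔸).toNonlinearRightInverse.nnnorm) with h0 | h0
    · exfalso
      have h5 := (ContinuousLinearEquiv.refl ℝ 𝔸).toNonlinearRightInverse.bound (k - 1)
      rw [← h0, zero_mul] at h5
      have h6 := (ContinuousLinearEquiv.refl ℝ 𝔸).toNonlinearRightInverse.right_inv (k - 1)
      rw [norm_le_zero_iff] at h5
      have h7 : (ContinuousLinearEquiv.refl ℝ 𝔸).toNonlinearRightInverse (k - 1) = k - 1 := h6
      exact hk0 (sub_eq_zero.1 (h7.symm.trans h5))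
    · have := (one_le_inv₀ h0).2 hnn
      have h1 : (0 : ℝ) ≤ ‖k - 1‖ := norm_nonneg _
      push_cast
      nlinarith)
  exact ⟨u, mem_closedBall_zero_iff.1 hu, huk.symm⟩

theorem exists_norm_sub_le_exp (𝔸 : Type*) [NormedRing 𝔸] [NormedAlgebra ℝ 𝔸] [CompleteSpace 𝔸] :
    ∃ δ : ℝ, 0 < δ ∧ ∀ X X' : 𝔸, ‖X‖ ≤ δ → ‖X'‖ ≤ δ →
      ‖X - X'‖ ≤ 2 * ‖NormedSpace.exp X - NormedSpace.exp X'‖ ∧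
      ‖NormedSpace.exp X - NormedSpace.exp X'‖ ≤ 2 * ‖X - X'‖ := by
  obtain ⟨δ, hδ, h⟩ := exists_lipschitz_prod_exp (𝔸 := 𝔸) [()] (c := 1 / 2) (by norm_num)
  refine ⟨δ, hδ, fun X X' hX hX' => ?_⟩
  have h1 := h (fun _ => X) (fun _ => X') ((pi_norm_const_le X).trans hX)
    ((pi_norm_const_le X').trans hX')
  have h2 : ‖(fun _ : Unit => X) - fun _ : Unit => X'‖ ≤ ‖X - X'‖ := pi_norm_const_le (X - X')
  simp only [List.map_cons, List.map_nil, List.prod_singleton, List.sum_singleton] at h1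
  set P := NormedSpace.exp X - NormedSpace.exp X'
  have h3 := norm_sub_norm_le (X - X') P
  have h4 := norm_sub_norm_le P (X - X')
  rw [norm_sub_rev (X - X') P] at h3
  constructor <;> linarith

end ProductsOfExponentials

/-! ### Finite-dimensional linear algebra: Neumann series and equivalence of norms -/

section FiniteDimensional

variable {V W : Type*} [NormedAddCommGroup V] [NormedSpace ℝ V] [FiniteDimensional ℝ V]

theorem exists_forall_norm_apply_le [NormedAddCommGroup W] [NormedSpace ℝ W] (f : V →ₗ[ℝ] W) :
    ∃ C : ℝ, 0 < C ∧ ∀ x, ‖f x‖ ≤ C * ‖x‖ := by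
  obtain ⟨C, hC, h⟩ := (LinearMap.toContinuousLinearMap f).bound
  exact ⟨C, hC, h⟩

/-- The Neumann series `∑ σ ^ j π`. -/
theorem exists_neumann (σ π : V →ₗ[ℝ] V) (F : Submodule ℝ V) {C q : ℝ} (hq : 0 ≤ q) (hq1 : q < 1)
    (hF : ∀ j u, (σ ^ j) (π u) ∈ F) (hb : ∀ j u, ‖(σ ^ j) (π u)‖ ≤ C * q ^ j * ‖u‖) :
    ∃ ρ : V →ₗ[ℝ] V, (∀ u, ρ u ∈ F) ∧ (∀ u, ‖ρ u‖ ≤ C * (1 - q)⁻¹ * ‖u‖) ∧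
      ∀ u, ρ u = π u + σ (ρ u) := by
  have hgeo := hasSum_geometric_of_lt_one hq hq1
  have hsb : ∀ u : V, HasSum (fun j : ℕ => C * q ^ j * ‖u‖) (C * (1 - q)⁻¹ * ‖u‖) := fun u =>
    (hgeo.mul_left C).mul_right _
  have hs : ∀ u, Summable fun j => (σ ^ j) (π u) := fun u =>
    Summable.of_norm_bounded (hsb u).summable (fun j => hb j u)
  refine ⟨{ toFun := fun u => ∑' j, (σ ^ j) (π u), map_add' := fun u v => ?_,
            map_smul' := fun c u => ?_ }, fun u => ?_, fun u => ?_, fun u => ?_⟩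
  · rw [← (hs u).tsum_add (hs v)]; simp
  · simp only [map_smul, RingHom.id_apply]
    exact (hs u).tsum_const_smul c
  · exact F.closed_of_finiteDimensional.mem_of_tendsto (hs u).hasSum.tendsto_sum_nat
      (Eventually.of_forall fun N => F.sum_mem fun j _ => hF j u)
  · exact tsum_of_norm_bounded (hsb u) (fun j => hb j u)
  · change ∑' j, (σ ^ j) (π u) = π u + σ (∑' j, (σ ^ j) (π u))
    have := (LinearMap.toContinuousLinearMap σ).map_tsum (hs u)
    simp only [LinearMap.coe_toContinuousLinearMap'] at this
    rw [this, (hs u).tsum_eq_zero_add]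
    simp [pow_succ']

theorem exists_seminorm_le {E : Type*} [AddCommGroup E] [Module ℝ E] [FiniteDimensional ℝ E]
    (p q : Seminorm ℝ E) (hp : ∀ x, x ≠ 0 → 0 < p x) :
    ∃ C : ℝ, 0 < C ∧ ∀ x, q x ≤ C * p x := by
  let : NormedAddCommGroup E := AddGroupNorm.toNormedAddCommGroup
    { toFun := p, map_zero' := map_zero p, add_le' := map_add_le_add p, neg' := map_neg_eq_map p,
      eq_zero_of_map_eq_zero' := fun x hx => by
        by_contra h; exact (hp x h).ne' hx }
  let : NormedSpace ℝ E := ⟨fun a b => (map_smul_eq_mul p a b).le⟩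
  let b := Module.finBasis ℝ E
  obtain ⟨C, hC, h⟩ := exists_forall_norm_apply_le b.equivFun.toLinearMap
  have hq : ∀ x, q x ≤ ∑ i, |b.repr x i| * q (b i) := fun x => by
    conv_lhs => rw [← b.sum_repr x]
    refine (Finset.le_sum_of_subadditive q (map_zero q).le (map_add_le_add q) _ _).trans
      (le_of_eq (Finset.sum_congr rfl fun i _ => ?_))
    rw [map_smul_eq_mul, Real.norm_eq_abs]
  refine ⟨C * (∑ i, q (b i)) + 1, ?_, fun x => ?_⟩
  · have : 0 ≤ ∑ i, q (b i) := Finset.sum_nonneg fun i _ => apply_nonneg q _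
    positivity
  · have hx : ∀ i, |b.repr x i| ≤ C * p x := fun i =>
      (norm_le_pi_norm (b.equivFun x) i).trans (h x)
    calc q x ≤ _ := hq x
      _ ≤ ∑ i, C * p x * q (b i) := by
        gcongr with i
        exact hx i
      _ = C * (∑ i, q (b i)) * p x := by rw [← Finset.mul_sum]; ring
      _ ≤ _ := by
        have := apply_nonneg p x
        nlinarith

end FiniteDimensional

/-! ### The limiting argument behind the closed subgroup theorem -/

section ClosedSubgroups

/-- A closed set stable under integer multiples contains no small vector transverse to the
subspace of the lines that it contains. -/
theorem exists_forall_transverse_eq_zero {V : Type*} [NormedAddCommGroup V] [NormedSpace ℝ V]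
    [FiniteDimensional ℝ V] {E : Set V} (hE : IsClosed E) (hneg : ∀ X ∈ E, -X ∈ E)
    (hnsmul : ∀ X ∈ E, ∀ k : ℕ, k • X ∈ E) (π : V →ₗ[ℝ] V)
    (hπ : ∀ X, (∀ t : ℝ, t • X ∈ E) → π X = X) :
    ∃ δ : ℝ, 0 < δ ∧ ∀ U ∈ E, ‖U‖ ≤ δ → π U = 0 → U = 0 := by
  -- Otherwise there are nonzero `U j ∈ E` tending to `0` in the kernel of `π`. A limit `W` of their
  -- directions is a unit vector with `π W = 0`. The multiples `⌊t / ‖U j‖⌋ • U j` tend to `t • W`,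
  -- so `E` contains the line of `W`, whence `π W = W`, a contradiction.
  by_contra! hcon
  have hp : ∀ j : ℕ, (0 : ℝ) < 1 / ((j : ℝ) + 1) := fun j => by positivity
  choose U hUE hU hU0 hUne using fun j : ℕ => hcon _ (hp j)
  have hUt : Tendsto (fun j => ‖U j‖) atTop (𝓝 0) :=
    squeeze_zero (fun _ => norm_nonneg _) hU tendsto_one_div_add_atTop_nhds_zero_nat
  have : ProperSpace V := FiniteDimensional.proper_real V
  obtain ⟨W, hW, φ, hφ, hlim⟩ := (isCompact_sphere (0 : V) 1).tendsto_subseq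
    (x := fun j => ‖U j‖⁻¹ • U j) (fun j => by simp [norm_smul, hUne j])
  have hπW : π W = 0 := by
    have h1 := ((LinearMap.continuous_of_finiteDimensional π).tendsto W).comp hlim
    refine tendsto_nhds_unique h1 ?_
    simp [Function.comp_def, hU0]
  have hpos : ∀ t : ℝ, 0 ≤ t → t • W ∈ E := by
    intro t ht
    have hr : Tendsto (fun j => (⌊t / ‖U (φ j)‖⌋₊ : ℝ) * ‖U (φ j)‖) atTop (𝓝 t) := by
      have hUφ := hUt.comp hφ.tendsto_atTop
      have hlow : Tendsto (fun j => t - ‖U (φ j)‖) atTop (𝓝 t) := by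
        simpa using tendsto_const_nhds.sub hUφ
      refine tendsto_of_tendsto_of_tendsto_of_le_of_le hlow tendsto_const_nhds
        (fun j => ?_) (fun j => ?_)
      · have hp : 0 < ‖U (φ j)‖ := norm_pos_iff.2 (hUne _)
        have := (Nat.sub_one_lt_floor (t / ‖U (φ j)‖)).le
        calc t - ‖U (φ j)‖ = (t / ‖U (φ j)‖ - 1) * ‖U (φ j)‖ := by field_simp
          _ ≤ _ := by gcongr
      · have hp : 0 < ‖U (φ j)‖ := norm_pos_iff.2 (hUne _)
        have := Nat.floor_le (a := t / ‖U (φ j)‖) (by positivity)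
        calc _ ≤ t / ‖U (φ j)‖ * ‖U (φ j)‖ := by gcongr
          _ = t := by field_simp
    refine hE.mem_of_tendsto (hr.smul hlim) (Eventually.of_forall fun j => ?_)
    have hp : ‖U (φ j)‖ ≠ 0 := norm_ne_zero_iff.2 (hUne _)
    simp only [Function.comp_apply]
    rw [smul_smul, mul_assoc, mul_inv_cancel₀ hp, mul_one, Nat.cast_smul_eq_nsmul]
    exact hnsmul _ (hUE _) _
  have hall : ∀ t : ℝ, t • W ∈ E := by
    intro t
    rcases le_total 0 t with ht | ht
    · exact hpos t ht
    · have := hneg _ (hpos (-t) (by linarith))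
      simpa using this
  have := hπ W hall
  rw [hπW] at this
  rw [← this] at hW
  simp at hW

end ClosedSubgroups

/-! ### Exponential coordinates on closed matrix groups -/

section MatrixGroups

open scoped Matrix.Norms.Operator

variable {n : ℕ}

theorem expGL_neg (X : RMat n) : expGL (-X) = (expGL X)⁻¹ := by
  apply Units.ext
  rfl

theorem expGL_list_prod {ι : Type*} (l : List ι) (f : ι → RMat n) :
    (((l.map fun i => expGL (f i)).prod : GL (Fin n) ℝ) : RMat n) =
      (l.map fun i => NormedSpace.exp (f i)).prod := by
  induction l with
  | nil => simp
  | cons i l ih => simp only [List.map_cons, List.prod_cons, Units.val_mul, ih]; rfl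

theorem expGL_mem {H : ClosedSubgroup (GL (Fin n) ℝ)} {X : RMat n} (hX : X ∈ lieSubspace H) :
    expGL X ∈ H := by simpa using hX 1

theorem exists_projection (F : Submodule ℝ (RMat n)) :
    ∃ π : RMat n →ₗ[ℝ] RMat n, (∀ u, π u ∈ F) ∧ ∀ u ∈ F, π u = u := by
  obtain ⟨g, hg⟩ := LinearMap.exists_leftInverse_of_injective F.subtype (by simp)
  refine ⟨F.subtype ∘ₗ g, fun u => (g u).2, fun u hu => ?_⟩
  have := LinearMap.congr_fun hg ⟨u, hu⟩
  simpa using congrArg Subtype.val this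

/-- Every element of `H` close to `1` is a product of exponentials `exp (T i u)`, for linear
endomorphisms `T i` of the Lie algebra of sum `1`. -/
theorem exists_eq_prod_expGL (H : ClosedSubgroup (GL (Fin n) ℝ)) {ι : Type*} [Fintype ι]
    (l : List ι) (C₁ : ℝ) :
    ∃ δ : ℝ, 0 < δ ∧ ∃ C₂ : ℝ, 0 < C₂ ∧ ∀ T : ι → RMat n →ₗ[ℝ] RMat n,
      (∀ i u, ‖T i u‖ ≤ C₁ * ‖u‖) → (∀ i, ∀ u ∈ lieSubspace H, T i u ∈ lieSubspace H) →
      (∀ u ∈ lieSubspace H, (l.map fun i => T i u).sum = u) →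
      ∀ k ∈ H, ‖(k : RMat n) - 1‖ ≤ δ →
        ∃ u ∈ lieSubspace H, ‖u‖ ≤ C₂ * ‖(k : RMat n) - 1‖ ∧
          k = (l.map fun i => expGL (T i u)).prod := by
  obtain ⟨π, hπ, hπ'⟩ := exists_projection (lieSubspace H)
  obtain ⟨Cπ, hCπ, hb⟩ := exists_forall_norm_apply_le π
  obtain ⟨δ₁, hδ₁, h₁⟩ := exists_forall_transverse_eq_zero (E := {X : RMat n | expGL X ∈ H})
    (H.isClosed'.preimage continuous_expGL)
    (fun X hX => by
      simp only [Set.mem_ofPred_eq, expGL_neg]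
      exact inv_mem hX)
    (fun X hX k => by
      simp only [Set.mem_ofPred_eq, expGL_nsmul]
      exact pow_mem hX k) π (fun X hX => hπ' X hX)
  obtain ⟨δ₂, hδ₂, h₂⟩ := exists_eq_prod_exp (RMat n) (l.map some ++ [none])
    (max (C₁ * Cπ) (1 + Cπ))
  refine ⟨min δ₂ (δ₁ / (2 * (1 + Cπ))), by positivity, Cπ * 2, by positivity,
    fun T hT hTm hsum k hk hkδ => ?_⟩
  -- An extra factor `exp(u - π u)`, transverse to the Lie algebra, makes the maps sum to the
  -- identity on all matrices. When `k ∈ H` this factor also lies in `H`, so it is trivial by the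
  -- transversality lemma.
  set T' : Option ι → RMat n →ₗ[ℝ] RMat n := fun o => o.elim (LinearMap.id - π) fun i => T i ∘ₗ π
  have hT' : ∀ o u, ‖T' o u‖ ≤ max (C₁ * Cπ) (1 + Cπ) * ‖u‖ := by
    rintro (_ | i) u
    · calc ‖u - π u‖ ≤ ‖u‖ + ‖π u‖ := norm_sub_le _ _
        _ ≤ ‖u‖ + Cπ * ‖u‖ := by gcongr; exact hb u
        _ = (1 + Cπ) * ‖u‖ := by ring
        _ ≤ _ := by gcongr; exact le_max_right _ _
    · by_cases hC : 0 ≤ C₁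
      · calc ‖T i (π u)‖ ≤ C₁ * ‖π u‖ := hT i _
          _ ≤ C₁ * (Cπ * ‖u‖) := by gcongr; exact hb u
          _ = (C₁ * Cπ) * ‖u‖ := by ring
          _ ≤ _ := by gcongr; exact le_max_left _ _
      · have h0 := hT i (π u)
        have h1 : C₁ * ‖π u‖ ≤ 0 := mul_nonpos_of_nonpos_of_nonneg (by linarith) (norm_nonneg _)
        have h2 : (0 : ℝ) ≤ max (C₁ * Cπ) (1 + Cπ) :=
          le_trans (by positivity) (le_max_right _ _)
        exact (h0.trans h1).trans (by positivity)
  obtain ⟨u, hu, hku⟩ := h₂ T' hT' (fun u => by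
    have := hsum (π u) (hπ u)
    simp only [List.map_append, List.map_map, List.sum_append, List.map_cons, List.map_nil,
      List.sum_singleton]
    change (l.map fun i => T i (π u)).sum + (u - π u) = u
    rw [this]; abel) k (hkδ.trans (min_le_left _ _))
  have hku' : k = (l.map fun i => expGL (T i (π u))).prod * expGL (u - π u) := by
    apply Units.ext
    rw [hku, Units.val_mul, expGL_list_prod]
    simp [T', Function.comp_def, expGL_val]
    rfl
  have hprod : (l.map fun i => expGL (T i (π u))).prod ∈ H := by
    refine list_prod_mem fun g hg => ?_
    obtain ⟨i, -, rfl⟩ := List.mem_map.1 hg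
    exact expGL_mem (hTm i _ (hπ u))
  have hexp : expGL (u - π u) ∈ H := by
    have : expGL (u - π u) = ((l.map fun i => expGL (T i (π u))).prod)⁻¹ * k := by
      rw [hku']; group
    rw [this]
    exact mul_mem (inv_mem hprod) hk
  have hsmall : ‖u - π u‖ ≤ δ₁ := by
    calc ‖u - π u‖ ≤ ‖u‖ + ‖π u‖ := norm_sub_le _ _
      _ ≤ ‖u‖ + Cπ * ‖u‖ := by gcongr; exact hb u
      _ = (1 + Cπ) * ‖u‖ := by ring
      _ ≤ (1 + Cπ) * (2 * (δ₁ / (2 * (1 + Cπ)))) := by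
        gcongr
        refine hu.trans ?_
        have := hkδ.trans (min_le_right _ _)
        linarith
      _ = δ₁ := by field_simp
  have hz : u - π u = 0 := h₁ _ hexp hsmall (by rw [map_sub, hπ' _ (hπ u), sub_self])
  refine ⟨π u, hπ u, ?_, ?_⟩
  · calc _ ≤ Cπ * ‖u‖ := hb u
      _ ≤ Cπ * (2 * ‖(k : RMat n) - 1‖) := by gcongr
      _ = _ := by ring
  · conv_lhs => rw [hku', hz, expGL_zero, mul_one]

end MatrixGroups

/-! ### Simultaneous diagonalization and restricted roots -/

theorem exists_basis_joint_eigenvector {V J : Type*} [AddCommGroup V] [Module ℝ V]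
    [FiniteDimensional ℝ V] (B : LinearMap.BilinForm ℝ V) (hsymm : ∀ x y, B x y = B y x)
    (hpos : ∀ x, x ≠ 0 → 0 < B x x) (f : J → V →ₗ[ℝ] V)
    (hf : ∀ j x y, B (f j x) y = B x (f j y)) (hcomm : ∀ i j, Commute (f i) (f j)) :
    ∃ (b : Module.Basis (Fin (Module.finrank ℝ V)) ℝ V) (χ : Fin (Module.finrank ℝ V) → J → ℝ),
      ∀ i j, f j (b i) = χ i j • b i := by
  classical
  let core : InnerProductSpace.Core ℝ V :=
    { inner := fun x y => B x y
      conj_inner_symm := fun x y => hsymm y x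
      re_inner_nonneg := fun x => by
        by_cases hx : x = 0
        · simp [hx]
        · exact (hpos x hx).le
      add_left := fun x y z => by simp
      smul_left := fun x y r => by simp
      definite := fun x hx => by
        by_contra h
        exact (hpos x h).ne' hx }
  let : NormedAddCommGroup V := core.toNormedAddCommGroup
  let : InnerProductSpace ℝ V := InnerProductSpace.ofCore core.toCore
  have hint := LinearMap.IsSymmetric.directSum_isInternal_of_pairwise_commute (T := f)
    (fun j x y => hf j x y) (fun i j _ => hcomm i j)
  let b := hint.collectedBasis fun χ => Module.Basis.ofVectorSpace ℝ _
  let e := b.indexEquiv (Module.finBasis ℝ V)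
  refine ⟨b.reindex e, fun i => (e.symm i).1, fun i j => ?_⟩
  have hm := hint.collectedBasis_mem (fun χ => Module.Basis.ofVectorSpace ℝ _) (e.symm i)
  rw [Submodule.mem_iInf] at hm
  have := Module.End.mem_eigenspace_iff.1 (hm j)
  simpa [b] using this

section RootBasis

variable {n : ℕ} {G : ClosedSubgroup (GL (Fin n) ℝ)} (D : CartanData G)

namespace CartanData

/-- Since `θ = -1` on `𝔞`, `θ` exchanges the root spaces of `α` and `-α`. -/
theorem theta_lie_eq {w : lieAlg G} (hw : w ∈ D.𝔞) (X : lieAlg G) : ⁅w, D.θ X⁆ = -D.θ ⁅w, X⁆ := by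
  rw [LieEquiv.map_lie, D.𝔞_le w hw, neg_lie, neg_neg]

/-- The form `-κ(X, θY)` is an inner product, and each `ad w` with `w ∈ 𝔞` is self-adjoint for it
because `θ w = -w`. These operators commute, so they are jointly diagonalizable. -/
theorem exists_root_basis : ∃ (b : Module.Basis (Fin (Module.finrank ℝ (lieAlg G))) ℝ (lieAlg G))
    (χ : Fin (Module.finrank ℝ (lieAlg G)) → Module.Dual ℝ D.𝔞),
    ∀ i (w : D.𝔞), ⁅(w : lieAlg G), b i⁆ = χ i w • b i := by
  have hθ : ∀ X Y, killingForm ℝ (lieAlg G) (D.θ X) Y = killingForm ℝ (lieAlg G) X (D.θ Y) := by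
    intro X Y
    conv_lhs => rw [← D.θ_invol Y]
    exact LieAlgebra.killingForm_of_equiv_apply D.θ X (D.θ Y)
  let B : LinearMap.BilinForm ℝ (lieAlg G) :=
    -(killingForm ℝ (lieAlg G)).compl₂ (D.θ : lieAlg G →ₗ[ℝ] lieAlg G)
  have hB : ∀ X Y, B X Y = -killingForm ℝ (lieAlg G) X (D.θ Y) := fun X Y => rfl
  obtain ⟨b, χ, h⟩ := exists_basis_joint_eigenvector B
    (fun X Y => by
      rw [hB, hB, ← hθ, LieModule.traceForm_comm])
    (fun X hX => D.θ_pos X hX) (fun w : D.𝔞 => (LieAlgebra.ad ℝ (lieAlg G) (w : lieAlg G)))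
    (fun w X Y => by
      rw [hB, hB, LieAlgebra.ad_apply, LieAlgebra.ad_apply, ← lie_skew, map_neg,
        LinearMap.neg_apply, LieModule.traceForm_apply_lie_apply, D.theta_lie_eq w.2, map_neg,
        neg_neg])
    (fun w w' => by
      have h0 := D.𝔞_abelian w w.2 w' w'.2
      have h1 := (LieAlgebra.ad ℝ (lieAlg G)).map_lie (w : lieAlg G) (w' : lieAlg G)
      rw [h0, map_zero] at h1
      exact (commute_iff_lie_eq).2 h1.symm)
  -- Reading the eigenvalue as a coordinate of `⁅w, b i⁆` shows that it is linear in `w`.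
  have hχ : ∀ i (w : D.𝔞), b.repr ⁅(w : lieAlg G), b i⁆ i = χ i w := fun i w => by
    have := h i w
    rw [LieAlgebra.ad_apply] at this
    rw [this]; simp
  refine ⟨b, fun i => { toFun := χ i, map_add' := fun w w' => ?_, map_smul' := fun c w => ?_ },
    h⟩
  · simp only [← hχ]; simp
  · simp only [← hχ]; simp

theorem continuous_toMat : Continuous D.toMat :=
  continuous_subtype_val.comp continuous_subtype_val

theorem toMat_injective : Function.Injective D.toMat :=
  Subtype.val_injective.comp Subtype.val_injective

/-- `toMat` as a linear map. -/
def toMatₗ : D.𝔞 →ₗ[ℝ] RMat n where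
  toFun := D.toMat
  map_add' _ _ := rfl
  map_smul' _ _ := rfl

theorem toMatₗ_apply (w : D.𝔞) : D.toMatₗ w = D.toMat w := rfl

/-- The topology of `𝔞` is induced from the matrices, so the form is extended to a linear form on
all matrices. -/
theorem continuous_dual (α : Module.Dual ℝ D.𝔞) : Continuous fun w => α w := by
  obtain ⟨g, hg⟩ := LinearMap.exists_leftInverse_of_injective D.toMatₗ
    (LinearMap.ker_eq_bot.2 D.toMat_injective)
  have h1 : Continuous fun X : RMat n => (α ∘ₗ g) X := LinearMap.continuous_of_finiteDimensional _
  refine (h1.comp D.continuous_toMat).congr fun w => ?_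
  have := LinearMap.congr_fun hg w
  simp only [LinearMap.comp_apply, toMatₗ_apply, LinearMap.id_apply] at this
  simp [this]

variable {D} in
-- A nonzero linear form takes negative values near any of its zeros: moving from `w` to `w - s v`
-- with `α v > 0` stays in the chamber for small `s`.
theorem IsPositiveRoot.pos_of_mem_interior {α : Module.Dual ℝ D.𝔞} (hα : D.IsPositiveRoot α)
    {w : D.𝔞} (hw : w ∈ interior D.chamber) : 0 < α w := by
  obtain ⟨v, hv⟩ : ∃ v, 0 < α v := by
    obtain ⟨v, hv⟩ := DFunLike.ne_iff.1 hα.1.1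
    rcases lt_or_gt_of_ne hv with h | h
    · exact ⟨-v, by simpa using h⟩
    · exact ⟨v, h⟩
  have hc : Continuous fun s : ℝ => w - s • v := by
    refine continuous_induced_rng.2 (continuous_induced_rng.2 ?_)
    change Continuous fun s : ℝ => D.toMat w - s • D.toMat v
    exact continuous_const.sub (continuous_id.smul continuous_const)
  have h0 : Tendsto (fun s : ℝ => w - s • v) (𝓝[>] 0) (𝓝 w) := by
    have := hc.tendsto 0
    simp only [zero_smul, sub_zero] at this
    exact this.mono_left nhdsWithin_le_nhds
  obtain ⟨s, hs, hs0⟩ := ((h0.eventually (isOpen_interior.mem_nhds hw)).and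
    self_mem_nhdsWithin).exists
  have := hα.2 _ (interior_subset hs)
  simp only [map_sub, map_smul, smul_eq_mul] at this
  have h1 : 0 < s * α v := mul_pos hs0 hv
  linarith

/-- A basis of joint eigenvectors of `𝔞`, with a vector in the interior of the chamber. -/
structure RootBasis where
  b : Module.Basis (Fin (Module.finrank ℝ (lieAlg G))) ℝ (lieAlg G)
  χ : Fin (Module.finrank ℝ (lieAlg G)) → Module.Dual ℝ D.𝔞
  lie_eq : ∀ i (w : D.𝔞), ⁅(w : lieAlg G), b i⁆ = χ i w • b i
  w₀ : D.𝔞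
  w₀_mem : w₀ ∈ interior D.chamber
  isPositiveRoot : ∀ i, 0 < χ i w₀ → D.IsPositiveRoot (χ i)
  isPositiveRoot_neg : ∀ i, χ i w₀ < 0 → D.IsPositiveRoot (-χ i)
  eq_zero : ∀ i, χ i w₀ = 0 → χ i = 0

theorem nonempty_rootBasis : Nonempty D.RootBasis := by
  obtain ⟨b, χ, h⟩ := D.exists_root_basis
  obtain ⟨w₀, hreg, hC⟩ := D.chamber_isWeylChamber
  have hroot : ∀ i, χ i ≠ 0 → IsRestrictedRoot D.𝔞 (χ i) := fun i hi => ⟨hi, b i, b.ne_zero i, h i⟩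
  have hroot' : ∀ i, χ i ≠ 0 → IsRestrictedRoot D.𝔞 (-χ i) := fun i hi =>
    ⟨neg_ne_zero.2 hi, D.θ (b i), fun h0 => b.ne_zero i (by
      rw [← D.θ_invol (b i), h0, map_zero]), fun w => by
      rw [D.theta_lie_eq w.2, h, map_smul, LinearMap.neg_apply, neg_smul]⟩
  have hpos : ∀ α, IsRestrictedRoot D.𝔞 α → 0 < α w₀ → D.IsPositiveRoot α := fun α hα h0 =>
    ⟨hα, fun w hw => by rw [hC] at hw; exact hw α hα h0⟩
  -- Expanding a root vector in the basis shows that every restricted root is some `χ i`. Only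
  -- finitely many half-spaces then define the chamber, so `w₀` is interior to it.
  have hex : ∀ α, IsRestrictedRoot D.𝔞 α → ∃ i, α = χ i := by
    rintro α ⟨hα, X, hX, hXα⟩
    obtain ⟨i, hi⟩ : ∃ i, b.repr X i ≠ 0 := by
      by_contra! hz
      exact hX (b.repr.map_eq_zero_iff.1 (Finsupp.ext hz))
    refine ⟨i, LinearMap.ext fun w => ?_⟩
    have h1 : ⁅(w : lieAlg G), X⁆ = ∑ j, (b.repr X j * χ j w) • b j := by
      conv_lhs => rw [← b.sum_repr X]
      rw [lie_sum]
      refine Finset.sum_congr rfl fun j _ => ?_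
      rw [lie_smul, h, smul_smul]
    have h2 := congrArg (fun Y => b.repr Y i) ((hXα w).symm.trans h1)
    simp only [map_smul, map_sum, Finsupp.smul_apply, Finsupp.coe_finsetSum, Finset.sum_apply,
      Module.Basis.repr_self, smul_eq_mul, Finsupp.single_apply, mul_ite, mul_one, mul_zero,
      Finset.sum_ite_eq', Finset.mem_univ, if_true] at h2
    rw [mul_comm] at h2
    exact mul_left_cancel₀ hi h2
  refine ⟨⟨b, χ, h, w₀, ?_, fun i hi => hpos _ (hroot i fun h0 => ?_) hi,
    fun i hi => hpos _ (hroot' i fun h0 => ?_) (by simpa using hi), fun i hi => ?_⟩⟩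
  · have hopen : IsOpen (⋂ i ∈ {i | 0 < χ i w₀}, {w | 0 < χ i w}) :=
      Set.Finite.isOpen_biInter (Set.toFinite _) fun i _ =>
        isOpen_lt continuous_const (D.continuous_dual _)
    refine mem_interior.2 ⟨_, fun w hw => ?_, hopen, ?_⟩
    · rw [hC]
      intro α hα h0
      obtain ⟨i, rfl⟩ := hex α hα
      exact (Set.mem_iInter₂.1 hw i h0).le
    · exact Set.mem_iInter₂.2 fun i hi => hi
  · simp [h0] at hi
  · simp [h0] at hi
  · by_contra h0
    exact hreg _ (hroot i h0) hi

end CartanData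
end RootBasis

/-! ### The adjoint action on matrices -/

section Conjugation

open scoped Matrix.Norms.Operator

variable {n : ℕ}

/-- The adjoint action of `GL_n(ℝ)` on matrices. -/
def conjL (g : GL (Fin n) ℝ) : RMat n →ₗ[ℝ] RMat n where
  toFun X := (g : RMat n) * X * ((g⁻¹ : GL (Fin n) ℝ) : RMat n)
  map_add' X Y := by rw [mul_add, add_mul]
  map_smul' c X := by rw [Matrix.mul_smul, Matrix.smul_mul]; rfl

theorem conjL_apply (g : GL (Fin n) ℝ) (X : RMat n) :
    conjL g X = (g : RMat n) * X * ((g⁻¹ : GL (Fin n) ℝ) : RMat n) := rfl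

theorem conjL_mul (g h : GL (Fin n) ℝ) (X : RMat n) : conjL (g * h) X = conjL g (conjL h X) := by
  simp only [conjL_apply, _root_.mul_inv_rev, Units.val_mul, mul_assoc]

theorem conjL_one (X : RMat n) : conjL 1 X = X := by simp [conjL_apply]

theorem conjL_pow (g : GL (Fin n) ℝ) (j : ℕ) (X : RMat n) : (conjL g ^ j) X = conjL (g ^ j) X := by
  induction j generalizing X with
  | zero => simp [conjL_one]
  | succ j ih => rw [pow_succ, Module.End.mul_apply, ih, pow_succ, conjL_mul]

theorem expGL_conjL (g : GL (Fin n) ℝ) (X : RMat n) : expGL (conjL g X) = g * expGL X * g⁻¹ :=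
  expGL_conj g X

/-- The hypothesis says `X Y = Y (X + c)`, hence `exp X · Y = Y · exp(X + c) = e^c Y exp X`. -/
theorem conjL_expGL_of_eigenvector {X Y : RMat n} {c : ℝ} (h : X * Y - Y * X = c • Y) :
    conjL (expGL X) Y = Real.exp c • Y := by
  have h1 : SemiconjBy Y (X + c • (1 : RMat n)) X := by
    change Y * (X + c • (1 : RMat n)) = X * Y
    rw [mul_add, Matrix.mul_smul, mul_one, ← h]; abel
  have h2 : NormedSpace.exp X * Y = Y * NormedSpace.exp (X + c • (1 : RMat n)) := h1.exp_right.symm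
  have h3 : NormedSpace.exp (X + c • (1 : RMat n)) = Real.exp c • NormedSpace.exp X := by
    rw [Matrix.exp_add_of_commute _ _ ((Commute.one_right X).smul_right c)]
    have : NormedSpace.exp (c • (1 : RMat n)) = Real.exp c • (1 : RMat n) := by
      have := (NormedSpace.algebraMap_exp_comm (𝔸 := RMat n) c).symm
      rw [Algebra.algebraMap_eq_smul_one, Algebra.algebraMap_eq_smul_one, ← Real.exp_eq_exp_ℝ] at this
      exact this
    rw [this, Matrix.mul_smul, mul_one]
  rw [conjL_apply, expGL_val, h2, h3, Matrix.mul_smul, Matrix.smul_mul, mul_assoc, ← expGL_val,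
    Units.mul_inv, mul_one]

theorem exists_norm_conjL_le {K : Set (GL (Fin n) ℝ)} (hK : IsCompact K) :
    ∃ C : ℝ, 0 < C ∧ ∀ k ∈ K, ∀ X : RMat n, ‖conjL k X‖ ≤ C * ‖X‖ := by
  have h1 : Continuous fun k : GL (Fin n) ℝ => ‖(k : RMat n)‖ :=
    continuous_norm.comp Units.continuous_val
  have h2 : Continuous fun k : GL (Fin n) ℝ => ‖((k⁻¹ : GL (Fin n) ℝ) : RMat n)‖ :=
    continuous_norm.comp (Units.continuous_val.comp continuous_inv)
  obtain ⟨C₁, hC₁⟩ := hK.exists_bound_of_continuousOn h1.continuousOn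
  obtain ⟨C₂, hC₂⟩ := hK.exists_bound_of_continuousOn h2.continuousOn
  refine ⟨max C₁ 1 * max C₂ 1, by positivity, fun k hk X => ?_⟩
  have h3 : ‖(k : RMat n)‖ ≤ max C₁ 1 := by
    have := hC₁ k hk
    rw [norm_norm] at this
    exact this.trans (le_max_left _ _)
  have h4 : ‖((k⁻¹ : GL (Fin n) ℝ) : RMat n)‖ ≤ max C₂ 1 := by
    have := hC₂ k hk
    rw [norm_norm] at this
    exact this.trans (le_max_left _ _)
  calc ‖conjL k X‖ ≤ ‖(k : RMat n)‖ * ‖X‖ * ‖((k⁻¹ : GL (Fin n) ℝ) : RMat n)‖ :=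
        (norm_mul_le _ _).trans (by gcongr; exact norm_mul_le _ _)
    _ ≤ max C₁ 1 * ‖X‖ * max C₂ 1 := by gcongr
    _ = _ := by ring

theorem conjL_mem_horospherical {G : ClosedSubgroup (GL (Fin n) ℝ)} {S : Set (RMat n)}
    {g : GL (Fin n) ℝ} (hg : g ∈ G) (hS : ∀ X ∈ S, ∀ t : ℝ, Commute g (expGL (t • X)))
    {h : GL (Fin n) ℝ} (hh : h ∈ horospherical G S) : g * h * g⁻¹ ∈ horospherical G S := by
  refine ⟨mul_mem (mul_mem hg hh.1) (inv_mem hg), fun X hX => ?_⟩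
  have h1 := (hh.2 X hX).const_mul g |>.mul_const g⁻¹
  rw [mul_one, mul_inv_cancel] at h1
  refine h1.congr fun t => ?_
  have hc := (hS X hX t).eq
  have hc' := ((hS X hX t).inv_right.inv_left).eq
  calc g * (expGL (t • X) * h * (expGL (t • X))⁻¹) * g⁻¹
      = (g * expGL (t • X)) * h * ((expGL (t • X))⁻¹ * g⁻¹) := by group
    _ = _ := by rw [hc, ← hc']; group

theorem conjL_mem_lieSubspace {H : ClosedSubgroup (GL (Fin n) ℝ)} {g : GL (Fin n) ℝ}
    (hg : ∀ h ∈ H, g * h * g⁻¹ ∈ H) {X : RMat n} (hX : X ∈ lieSubspace H) :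
    conjL g X ∈ lieSubspace H := fun t => by
  rw [← map_smul, expGL_conjL]
  exact hg _ (hX t)

end Conjugation

/-! ### The subgroups `A`, `M`, `N`, `N⁺` and `N⁺AM` -/

namespace CartanData

open scoped Matrix.Norms.Operator

variable {n : ℕ} {G : ClosedSubgroup (GL (Fin n) ℝ)} (D : CartanData G)

theorem expA_mem (w : D.𝔞) : D.expA w ∈ G :=
  expGL_mem (H := G) (X := D.toMat w) (w : lieAlg G).2

theorem commute_toMat (w w' : D.𝔞) : Commute (D.toMat w) (D.toMat w') := by
  have h := congrArg (fun X : lieAlg G => (X : RMat n)) (D.𝔞_abelian w w.2 w' w'.2)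
  exact (commute_iff_lie_eq).2 h

theorem expA_add (w w' : D.𝔞) : D.expA (w + w') = D.expA w * D.expA w' := by
  apply Units.ext
  exact Matrix.exp_add_of_commute _ _ (D.commute_toMat w w')

theorem expA_zero : D.expA 0 = 1 := expGL_zero

theorem expA_neg (w : D.𝔞) : D.expA (-w) = (D.expA w)⁻¹ := expGL_neg _

theorem expA_nsmul (j : ℕ) (w : D.𝔞) : D.expA (j • w) = D.expA w ^ j := expGL_nsmul j _

theorem commute_expA (w w' : D.𝔞) : Commute (D.expA w) (D.expA w') := by
  rw [Commute, SemiconjBy, ← expA_add, ← expA_add, add_comm]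

/-- `M` as a subgroup. -/
def MSubgroup : Subgroup (GL (Fin n) ℝ) where
  carrier := D.M
  one_mem' := ⟨one_mem D.K, fun a _ => by simp⟩
  mul_mem' := fun {k l} hk hl => ⟨mul_mem hk.1 hl.1, fun a ha => by
    rw [mul_assoc, hl.2 a ha, ← mul_assoc, hk.2 a ha, mul_assoc]⟩
  inv_mem' := fun {k} hk => ⟨inv_mem hk.1, fun a ha => by
    have := hk.2 a ha
    rw [inv_mul_eq_iff_eq_mul, ← mul_assoc, this]; group⟩

variable {D} in
theorem commute_of_mem_M {m : GL (Fin n) ℝ} (hm : m ∈ D.M) (w : D.𝔞) : Commute m (D.expA w) :=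
  hm.2 _ ⟨w, rfl⟩

variable {D} in
theorem mem_of_mem_M {m : GL (Fin n) ℝ} (hm : m ∈ D.M) : m ∈ G := D.K_le m hm.1

theorem expGL_smul_toMat (t : ℝ) (w : D.𝔞) : expGL (t • D.toMat w) = D.expA (t • w) := rfl

theorem expGL_smul_neg_toMat (t : ℝ) (w : D.𝔞) : expGL (t • -D.toMat w) = D.expA (-(t • w)) := by
  rw [smul_neg]; rfl

/-- `A M` as a subgroup. -/
def AMSubgroup : Subgroup (GL (Fin n) ℝ) where
  carrier := {g | ∃ w, ∃ m ∈ D.M, g = D.expA w * m}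
  one_mem' := ⟨0, 1, one_mem D.MSubgroup, by simp [expA_zero]⟩
  mul_mem' := by
    rintro _ _ ⟨w, m, hm, rfl⟩ ⟨w', m', hm', rfl⟩
    refine ⟨w + w', m * m', D.MSubgroup.mul_mem hm hm', ?_⟩
    rw [expA_add, mul_assoc, ← mul_assoc m, (commute_of_mem_M hm w').eq]; group
  inv_mem' := by
    rintro _ ⟨w, m, hm, rfl⟩
    refine ⟨-w, m⁻¹, D.MSubgroup.inv_mem hm, ?_⟩
    rw [expA_neg, _root_.mul_inv_rev, (commute_of_mem_M hm w).inv_left.inv_right.eq]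

variable {D}

theorem commute_of_mem_AM {b : GL (Fin n) ℝ} (hb : b ∈ D.AMSubgroup) (w : D.𝔞) :
    Commute b (D.expA w) := by
  obtain ⟨v, m, hm, rfl⟩ := hb
  exact (D.commute_expA v w).mul_left (commute_of_mem_M hm w)

theorem mem_of_mem_AM {b : GL (Fin n) ℝ} (hb : b ∈ D.AMSubgroup) : b ∈ G := by
  obtain ⟨v, m, hm, rfl⟩ := hb
  exact mul_mem (D.expA_mem v) (mem_of_mem_M hm)

theorem conj_mem_Np {b : GL (Fin n) ℝ} (hb : b ∈ D.AMSubgroup) {h : GL (Fin n) ℝ}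
    (hh : h ∈ D.Np) : b * h * b⁻¹ ∈ D.Np :=
  conjL_mem_horospherical (mem_of_mem_AM hb) (by
    rintro X ⟨w, -, rfl⟩ t
    rw [expGL_smul_toMat]
    exact commute_of_mem_AM hb _) hh

theorem conj_mem_N {b : GL (Fin n) ℝ} (hb : b ∈ D.AMSubgroup) {h : GL (Fin n) ℝ}
    (hh : h ∈ D.N) : b * h * b⁻¹ ∈ D.N :=
  conjL_mem_horospherical (mem_of_mem_AM hb) (by
    rintro X ⟨w, -, rfl⟩ t
    rw [expGL_smul_neg_toMat]
    exact commute_of_mem_AM hb _) hh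

theorem mem_of_mem_N {h : GL (Fin n) ℝ} (hh : h ∈ D.N) : h ∈ G := hh.1

theorem mem_of_mem_Np {h : GL (Fin n) ℝ} (hh : h ∈ D.Np) : h ∈ G := hh.1

/-- The parabolic subgroup `N⁺ A M`. -/
def Pp (D : CartanData G) : Subgroup (GL (Fin n) ℝ) where
  carrier := {g | ∃ h ∈ D.Np, ∃ b ∈ D.AMSubgroup, g = h * b}
  one_mem' := ⟨1, one_mem _, 1, one_mem _, by simp⟩
  mul_mem' := by
    rintro _ _ ⟨h, hh, b, hb, rfl⟩ ⟨h', hh', b', hb', rfl⟩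
    exact ⟨h * (b * h' * b⁻¹), mul_mem hh (conj_mem_Np hb hh'), b * b', mul_mem hb hb', by group⟩
  inv_mem' := by
    rintro _ ⟨h, hh, b, hb, rfl⟩
    refine ⟨b⁻¹ * h⁻¹ * b⁻¹⁻¹, conj_mem_Np (inv_mem hb) (inv_mem hh), b⁻¹, inv_mem hb, by group⟩

/-- `X` generates a one-parameter subgroup of `M`. -/
def IsMTangent (D : CartanData G) (X : RMat n) : Prop :=
  X ∈ lieSubspace G ∧ ∀ t : ℝ, expGL (t • X) ∈ D.M

theorem IsMTangent.conj {X : RMat n} (hX : D.IsMTangent X) {m : GL (Fin n) ℝ} (hm : m ∈ D.M) :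
    D.IsMTangent (conjL m X) :=
  ⟨lieSubspace_conj G (mem_of_mem_M hm) hX.1, fun t => by
    rw [← map_smul, expGL_conjL]
    exact D.MSubgroup.mul_mem
      (D.MSubgroup.mul_mem hm (hX.2 t))
      (D.MSubgroup.inv_mem hm)⟩

theorem IsMTangent.expGL_mem {X : RMat n} (hX : D.IsMTangent X) : expGL X ∈ D.M := by
  simpa using hX.2 1

theorem isMTangent_of_fixed {V : lieAlg G} (hθ : D.θ V = V)
    (hV : ∀ w : D.𝔞, ⁅(w : lieAlg G), V⁆ = 0) : D.IsMTangent (V : RMat n) := by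
  refine ⟨V.2, fun t => ⟨(D.K_lieAlg V).2 hθ t, ?_⟩⟩
  rintro _ ⟨w, rfl⟩
  have hc : Commute (D.toMat w) (V : RMat n) :=
    (commute_iff_lie_eq).2 (congrArg (fun X : lieAlg G => (X : RMat n)) (hV w))
  apply Units.ext
  exact ((hc.smul_right t).exp).symm.eq

end CartanData

/-! ### The root space decomposition and its projections -/

namespace CartanData

namespace RootBasis

open scoped Matrix.Norms.Operator

variable {n : ℕ} {G : ClosedSubgroup (GL (Fin n) ℝ)} {D : CartanData G} (E : D.RootBasis)

theorem toMat_mul_sub (i) (w : D.𝔞) :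
    D.toMat w * (E.b i : RMat n) - (E.b i : RMat n) * D.toMat w = E.χ i w • (E.b i : RMat n) :=
  congrArg (fun X : lieAlg G => (X : RMat n)) (E.lie_eq i w)

theorem conjL_expA (i) (w : D.𝔞) :
    conjL (D.expA w) (E.b i : RMat n) = Real.exp (E.χ i w) • (E.b i : RMat n) :=
  conjL_expGL_of_eigenvector (E.toMat_mul_sub i w)

theorem tendsto_conj_expA (i) (w : D.𝔞) (hw : E.χ i w < 0) (t : ℝ) :
    Tendsto (fun s : ℝ => D.expA (s • w) * expGL (t • (E.b i : RMat n)) * (D.expA (s • w))⁻¹)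
      atTop (𝓝 1) := by
  have h1 : Tendsto (fun s : ℝ => Real.exp (s * E.χ i w)) atTop (𝓝 0) :=
    Real.tendsto_exp_atBot.comp (tendsto_id.atTop_mul_const_of_neg hw)
  have h2 : Tendsto (fun s : ℝ => t • Real.exp (s * E.χ i w) • (E.b i : RMat n)) atTop
      (𝓝 (t • (0 : ℝ) • (E.b i : RMat n))) := (h1.smul_const _).const_smul t
  rw [zero_smul, smul_zero] at h2
  have h3 := (continuous_expGL.tendsto _).comp h2
  rw [expGL_zero] at h3
  refine h3.congr fun s => ?_
  have := E.conjL_expA i (s • w)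
  rw [map_smul, smul_eq_mul] at this
  rw [Function.comp_apply, ← this, ← map_smul, expGL_conjL]

/-- Sign convention: `N⁺` is the group contracted by `exp(tw)`, so its Lie algebra contains the root
vectors of negative roots. -/
theorem b_mem_Np {i} (hi : E.χ i E.w₀ < 0) : (E.b i : RMat n) ∈ lieSubspace D.Np := by
  refine fun t => ⟨(E.b i).2 t, ?_⟩
  rintro X ⟨w, hw, rfl⟩
  have := (E.isPositiveRoot_neg i hi).pos_of_mem_interior hw
  rw [LinearMap.neg_apply] at this
  exact E.tendsto_conj_expA i w (by linarith) t

theorem b_mem_N {i} (hi : 0 < E.χ i E.w₀) : (E.b i : RMat n) ∈ lieSubspace D.N := by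
  refine fun t => ⟨(E.b i).2 t, ?_⟩
  rintro X ⟨w, hw, rfl⟩
  have := (E.isPositiveRoot i hi).pos_of_mem_interior hw
  have h := E.tendsto_conj_expA i (-w) (by rw [map_neg]; linarith) t
  refine h.congr fun s => ?_
  rw [expGL_smul_neg_toMat, smul_neg]

/-- It extends the coordinates of `𝔤` to all matrices, so that the projections become endomorphisms
of the matrix space. -/
theorem exists_linear_retraction (G : ClosedSubgroup (GL (Fin n) ℝ)) :
    ∃ p : RMat n →ₗ[ℝ] lieAlg G, ∀ X : lieAlg G, p X = X := by
  obtain ⟨g, hg⟩ := LinearMap.exists_leftInverse_of_injective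
    ((lieAlg G).toSubmodule.subtype) (by simp)
  exact ⟨g, fun X => LinearMap.congr_fun hg X⟩

/-- The projection of matrices to the span of the `E.b i`, `i ∈ s`. -/
def proj (s : Finset (Fin (Module.finrank ℝ (lieAlg G)))) : RMat n →ₗ[ℝ] lieAlg G :=
  ∑ i ∈ s, ((E.b.coord i) ∘ₗ (exists_linear_retraction G).choose).smulRight (E.b i)

/-- The `i`-th coordinate of a matrix. -/
def coord (i : Fin (Module.finrank ℝ (lieAlg G))) : RMat n →ₗ[ℝ] ℝ := (E.b.coord i) ∘ₗ (exists_linear_retraction G).choose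

theorem proj_apply (s) (u : RMat n) : E.proj s u = ∑ i ∈ s, E.coord i u • E.b i := by
  simp [proj, coord]

theorem coe_proj (s) (u : RMat n) :
    (E.proj s u : RMat n) = ∑ i ∈ s, E.coord i u • (E.b i : RMat n) := by
  rw [proj_apply]
  exact map_sum (lieAlg G).toSubmodule.subtype _ _

/-- The indices of `𝔫⁺`. -/
def negIdx : Finset (Fin (Module.finrank ℝ (lieAlg G))) := {i | E.χ i E.w₀ < 0}

/-- The indices of `𝔫`. -/
def posIdx : Finset (Fin (Module.finrank ℝ (lieAlg G))) := {i | 0 < E.χ i E.w₀}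

/-- The indices of the centralizer of `𝔞`. -/
def zeroIdx : Finset (Fin (Module.finrank ℝ (lieAlg G))) := {i | E.χ i E.w₀ = 0}

theorem sum_coord {u : RMat n} (hu : u ∈ lieSubspace G) :
    ∑ i, E.coord i u • (E.b i : RMat n) = u := by
  have h := E.b.sum_repr ⟨u, hu⟩
  have h2 : (exists_linear_retraction G).choose u = ⟨u, hu⟩ :=
    (exists_linear_retraction G).choose_spec ⟨u, hu⟩
  have h3 := congrArg (lieAlg G).toSubmodule.subtype h
  rw [map_sum] at h3
  refine Eq.trans (Finset.sum_congr rfl fun i _ => ?_) h3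
  rw [coord, LinearMap.comp_apply, h2]
  rfl

theorem proj_add_proj_add_proj {u : RMat n} (hu : u ∈ lieSubspace G) :
    (E.proj E.negIdx u : RMat n) + E.proj E.posIdx u + E.proj E.zeroIdx u = u := by
  conv_rhs => rw [← E.sum_coord hu]
  simp only [coe_proj, negIdx, posIdx, zeroIdx, Finset.sum_filter]
  rw [← Finset.sum_add_distrib, ← Finset.sum_add_distrib]
  refine Finset.sum_congr rfl fun i _ => ?_
  rcases lt_trichotomy (E.χ i E.w₀) 0 with h | h | h
  · simp [h, h.le, h.ne]
  · simp [h]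
  · simp [h, h.le, h.ne']

/-- The projection to `𝔫⁺`. -/
def πp : RMat n →ₗ[ℝ] RMat n := (lieAlg G).toSubmodule.subtype ∘ₗ E.proj E.negIdx

/-- The projection to `𝔫`. -/
def πm : RMat n →ₗ[ℝ] RMat n := (lieAlg G).toSubmodule.subtype ∘ₗ E.proj E.posIdx

/-- The projection to `𝔞`. -/
def πa : RMat n →ₗ[ℝ] RMat n := (lieAlg G).toSubmodule.subtype ∘ₗ
  ((1 / 2 : ℝ) • (LinearMap.id - (D.θ : lieAlg G →ₗ[ℝ] lieAlg G))) ∘ₗ E.proj E.zeroIdx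

/-- The projection to the Lie algebra of `M`. -/
def πk : RMat n →ₗ[ℝ] RMat n := (lieAlg G).toSubmodule.subtype ∘ₗ
  ((1 / 2 : ℝ) • (LinearMap.id + (D.θ : lieAlg G →ₗ[ℝ] lieAlg G))) ∘ₗ E.proj E.zeroIdx

theorem sum_π {u : RMat n} (hu : u ∈ lieSubspace G) : E.πp u + E.πm u + E.πa u + E.πk u = u := by
  have h : E.πa u + E.πk u = E.proj E.zeroIdx u := by
    have : (1 / 2 : ℝ) • (E.proj E.zeroIdx u - D.θ (E.proj E.zeroIdx u)) +
      (1 / 2 : ℝ) • (E.proj E.zeroIdx u + D.θ (E.proj E.zeroIdx u)) = E.proj E.zeroIdx u := by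
      module
    exact congrArg (fun X : lieAlg G => (X : RMat n)) this
  rw [add_assoc, h]
  exact E.proj_add_proj_add_proj hu

theorem πp_mem (u : RMat n) : E.πp u ∈ lieSubspace D.Np := by
  change (E.proj E.negIdx u : RMat n) ∈ _
  rw [coe_proj]
  exact Submodule.sum_mem _ fun i hi => Submodule.smul_mem _ _
    (E.b_mem_Np (by simpa [negIdx] using hi))

theorem πm_mem (u : RMat n) : E.πm u ∈ lieSubspace D.N := by
  change (E.proj E.posIdx u : RMat n) ∈ _
  rw [coe_proj]
  exact Submodule.sum_mem _ fun i hi => Submodule.smul_mem _ _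
    (E.b_mem_N (by simpa [posIdx] using hi))

theorem lie_proj_zero (u : RMat n) (w : D.𝔞) : ⁅(w : lieAlg G), E.proj E.zeroIdx u⁆ = 0 := by
  rw [proj_apply, lie_sum]
  refine Finset.sum_eq_zero fun i hi => ?_
  rw [lie_smul, E.lie_eq, E.eq_zero i (by simpa [zeroIdx] using hi)]
  simp

theorem lie_theta_proj_zero (u : RMat n) (w : D.𝔞) :
    ⁅(w : lieAlg G), D.θ (E.proj E.zeroIdx u)⁆ = 0 := by
  rw [D.theta_lie_eq w.2, lie_proj_zero, map_zero, neg_zero]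

/-- For `V` centralizing `𝔞`, the vector `(V - θV)/2` lies in `𝔭` and centralizes `𝔞`, so maximality
puts it in `𝔞`. The other half, `(V + θV)/2`, lies in `𝔨` and generates a subgroup of `M`. -/
theorem πa_mem (u : RMat n) : ∃ w, E.πa u = D.toMat w := by
  set V := E.proj E.zeroIdx u with hV
  have h : (1 / 2 : ℝ) • (V - D.θ V) ∈ D.𝔞 := by
    refine D.𝔞_maximal _ ?_ fun Y hY => ?_
    · rw [map_smul, map_sub, D.θ_invol, ← smul_neg, neg_sub]
    · rw [← lie_skew, lie_smul, lie_sub, E.lie_proj_zero u ⟨Y, hY⟩, E.lie_theta_proj_zero u ⟨Y, hY⟩]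
      simp
  exact ⟨⟨_, h⟩, rfl⟩

theorem πk_mem (u : RMat n) : D.IsMTangent (E.πk u) := by
  set V := E.proj E.zeroIdx u with hV
  refine isMTangent_of_fixed (V := (1 / 2 : ℝ) • (V + D.θ V)) ?_ fun w => ?_
  · rw [map_smul, map_add, D.θ_invol, add_comm]
  · rw [lie_smul, lie_add, E.lie_proj_zero u w, E.lie_theta_proj_zero u w]
    simp

theorem conjL_b {b : GL (Fin n) ℝ} {w : D.𝔞} {m : GL (Fin n) ℝ} (i) (hb : b = D.expA w * m)
    (hm : m ∈ D.M) (j : ℕ) :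
    (conjL b ^ j) (E.b i : RMat n) = Real.exp (E.χ i w) ^ j • conjL (m ^ j) (E.b i : RMat n) := by
  rw [conjL_pow, hb, ((commute_of_mem_M hm w).symm).mul_pow, ← expA_nsmul,
    ((commute_of_mem_M (D.MSubgroup.pow_mem hm j) (j • w)).symm).eq, conjL_mul, conjL_expA,
    map_smul, map_nsmul, nsmul_eq_mul, Real.exp_nat_mul]

/-- On `b i` the `j`-th power acts as `e^{j χ i w} Ad(m^j)`, and `m^j` stays in the compact group
`K`. Hence `C` does not depend on `w`, `m` or `j`. -/
theorem exists_norm_conjL_pow_proj_le (s) : ∃ C : ℝ, 0 < C ∧ ∀ (w : D.𝔞) (T : ℝ),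
    (∀ i ∈ s, E.χ i w ≤ -T) → ∀ m ∈ D.M, ∀ (j : ℕ) (u : RMat n),
      ‖(conjL (D.expA w * m) ^ j) (E.proj s u : RMat n)‖ ≤ C * Real.exp (-T) ^ j * ‖u‖ := by
  obtain ⟨CM, hCM, hM⟩ := exists_norm_conjL_le D.K_compact
  choose c hc hcb using fun i => exists_forall_norm_apply_le (E.coord i)
  refine ⟨∑ i ∈ s, c i * (CM * ‖(E.b i : RMat n)‖) + 1, ?_, fun w T hT m hm j u => ?_⟩
  · have : 0 ≤ ∑ i ∈ s, c i * (CM * ‖(E.b i : RMat n)‖) :=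
      Finset.sum_nonneg fun i _ => by have := hc i; positivity
    positivity
  · have h1 : ∀ i ∈ s, ‖(conjL (D.expA w * m) ^ j) (E.coord i u • (E.b i : RMat n))‖ ≤
        c i * (CM * ‖(E.b i : RMat n)‖) * (Real.exp (-T) ^ j * ‖u‖) := fun i hi => by
      rw [map_smul, E.conjL_b i rfl hm, norm_smul, norm_smul, norm_pow, Real.norm_eq_abs (Real.exp _),
        Real.abs_exp]
      have h2 := hM _ (pow_mem hm.1 j) (E.b i : RMat n)
      have h3 := hcb i u
      have h4 := Real.exp_le_exp.2 (hT i hi)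
      have h5 : 0 ≤ c i * ‖u‖ := (norm_nonneg _).trans h3
      calc _ ≤ (c i * ‖u‖) * (Real.exp (-T) ^ j * (CM * ‖(E.b i : RMat n)‖)) := by gcongr
        _ = _ := by ring
    rw [coe_proj, map_sum]
    calc _ ≤ ∑ i ∈ s, c i * (CM * ‖(E.b i : RMat n)‖) * (Real.exp (-T) ^ j * ‖u‖) :=
          (norm_sum_le _ _).trans (Finset.sum_le_sum h1)
      _ = (∑ i ∈ s, c i * (CM * ‖(E.b i : RMat n)‖)) * (Real.exp (-T) ^ j * ‖u‖) := by
          rw [Finset.sum_mul]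
      _ ≤ (∑ i ∈ s, c i * (CM * ‖(E.b i : RMat n)‖) + 1) * (Real.exp (-T) ^ j * ‖u‖) := by
          gcongr; linarith
      _ = _ := by ring

/-- An element of `𝔤` contracted to `0` by `exp(t w₀)` both for `t → ∞` and for `t → -∞`
vanishes. -/
theorem eq_zero_of_tendsto {Y : RMat n} (hY : Y ∈ lieSubspace G)
    (h₁ : Tendsto (fun t : ℝ => conjL (D.expA (t • E.w₀)) Y) atTop (𝓝 0))
    (h₂ : Tendsto (fun t : ℝ => conjL (D.expA (-(t • E.w₀))) Y) atTop (𝓝 0)) : Y = 0 := by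
  have hconj : ∀ (i) (w : D.𝔞), E.coord i (conjL (D.expA w) Y) = Real.exp (E.χ i w) * E.coord i Y := by
    intro i w
    have hb : ∀ k, E.coord i (E.b k : RMat n) = if k = i then 1 else 0 := fun k => by
      rw [coord, LinearMap.comp_apply, (exists_linear_retraction G).choose_spec (E.b k)]
      simp [Finsupp.single_apply]
    conv_lhs => rw [← E.sum_coord hY]
    simp only [map_sum, map_smul, conjL_expA, hb, smul_eq_mul]
    simp [mul_comm]
  have hz : ∀ i, E.coord i Y = 0 := by
    intro i
    have hc : Continuous (E.coord i) := LinearMap.continuous_of_finiteDimensional _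
    by_contra hne
    -- The `i`-th coordinate is multiplied by `e^{t χ i w} ≥ 1` for `t ≥ 0`, so it cannot tend to
    -- `0` unless it vanishes. One of `w₀`, `-w₀` satisfies the sign condition.
    have key : ∀ w : D.𝔞, 0 ≤ E.χ i w →
        ¬ Tendsto (fun t : ℝ => conjL (D.expA (t • w)) Y) atTop (𝓝 0) := by
      intro w hw ht
      have h := (hc.tendsto 0).comp ht
      rw [map_zero] at h
      have h3 := (h.abs).eventually_lt_const (u := |E.coord i Y|) (by simpa using hne)
      obtain ⟨t, ht1, ht2⟩ := (h3.and (eventually_ge_atTop 0)).exists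
      simp only [Function.comp_apply, hconj, abs_mul, Real.abs_exp, map_smul, smul_eq_mul] at ht1
      have h4 : 1 ≤ Real.exp (t * E.χ i w) := Real.one_le_exp (by positivity)
      have h5 := abs_nonneg (E.coord i Y)
      nlinarith
    rcases le_total 0 (E.χ i E.w₀) with h | h
    · exact key _ h h₁
    · refine key (-E.w₀) (by rw [map_neg]; linarith) (h₂.congr fun t => ?_)
      rw [smul_neg]
  rw [← E.sum_coord hY]
  simp [hz]

/-- Write `g = h b` with `h ∈ N⁺`, `b ∈ AM`. As `b` fixes `w₀`, the vector `Ad g w₀ - w₀` equals `Ad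
h w₀ - w₀`, which `exp(t w₀)` contracts as `t → ∞`; since `g ∈ N` it is also contracted as `t → -∞`.
So it vanishes, `g` commutes with `exp(t w₀)`, and the contraction of `g` to `1` is constant. -/
theorem eq_one_of_mem_N_of_mem_Pp (E : D.RootBasis) {g : GL (Fin n) ℝ} (hN : g ∈ D.N) (hP : g ∈ D.Pp) : g = 1 := by
  obtain ⟨h, hh, b, hb, hg⟩ := hP
  have hw0 : ∀ v : D.𝔞, conjL (D.expA v) (D.toMat E.w₀) = D.toMat E.w₀ := fun v => by
    have hc : Commute (D.expA v : RMat n) (D.toMat E.w₀) :=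
      ((D.commute_toMat v E.w₀).symm.exp_right).symm
    rw [conjL_apply, hc.eq, mul_assoc, Units.mul_inv, mul_one]
  have key : ∀ (g : GL (Fin n) ℝ) (v : ℝ → D.𝔞),
      Tendsto (fun t => D.expA (v t) * g * (D.expA (v t))⁻¹) atTop (𝓝 1) →
      Tendsto (fun t => conjL (D.expA (v t)) (conjL g (D.toMat E.w₀) - D.toMat E.w₀)) atTop
        (𝓝 0) := by
    intro g v hg
    have hc : Continuous fun k : GL (Fin n) ℝ => conjL k (D.toMat E.w₀) - D.toMat E.w₀ :=
      ((Units.continuous_val.mul continuous_const).mul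
        (Units.continuous_val.comp continuous_inv)).sub continuous_const
    have h1 := (hc.tendsto 1).comp hg
    simp only [conjL_one, sub_self] at h1
    refine h1.congr fun t => ?_
    simp only [Function.comp_apply]
    rw [conjL_mul, conjL_mul, map_sub, hw0, ← expA_neg, hw0]
  have hYeq : conjL g (D.toMat E.w₀) = conjL h (D.toMat E.w₀) := by
    obtain ⟨v, m, hm, rfl⟩ := hb
    -- Differentiate `m exp(s w₀) m⁻¹ = exp(s w₀)` at `s = 0`.
    have hm0 : conjL m (D.toMat E.w₀) = D.toMat E.w₀ := by
      have h1 := ((hasDerivAt_exp_smul_zero (D.toMat E.w₀)).const_mul (m : RMat n)).mul_const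
        ((m⁻¹ : GL (Fin n) ℝ) : RMat n)
      refine h1.unique ((hasDerivAt_exp_smul_zero (D.toMat E.w₀)).congr_of_eventuallyEq
        (Eventually.of_forall fun s => ?_))
      have h2 := congrArg Units.val (commute_of_mem_M hm (s • E.w₀)).eq
      change (m : RMat n) * (D.expA (s • E.w₀) : RMat n) * _ = (D.expA (s • E.w₀) : RMat n)
      rw [← Units.val_mul, h2, Units.val_mul, mul_assoc, Units.mul_inv, mul_one]
    rw [hg, conjL_mul, conjL_mul, hm0, hw0]
  have hY : conjL g (D.toMat E.w₀) - D.toMat E.w₀ = 0 := by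
    refine E.eq_zero_of_tendsto ?_ ?_ ?_
    · exact Submodule.sub_mem _ (lieSubspace_conj G hN.1 (E.w₀ : lieAlg G).2) (E.w₀ : lieAlg G).2
    · rw [hYeq]
      exact key h (fun t => t • E.w₀) (hh.2 _ ⟨E.w₀, E.w₀_mem, rfl⟩)
    · refine key g (fun t => -(t • E.w₀)) ((hN.2 _ ⟨E.w₀, E.w₀_mem, rfl⟩).congr fun t => ?_)
      rw [expGL_smul_neg_toMat]
  rw [sub_eq_zero] at hY
  have hcomm : ∀ t : ℝ, g * D.expA (t • E.w₀) * g⁻¹ = D.expA (t • E.w₀) := fun t => by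
    have := expGL_conjL g (t • D.toMat E.w₀)
    rw [map_smul, hY] at this
    exact this.symm
  refine tendsto_nhds_unique ((tendsto_const_nhds (x := g) (f := (atTop : Filter ℝ))).congr
    fun t => ?_) (hN.2 _ ⟨E.w₀, E.w₀_mem, rfl⟩)
  rw [expGL_smul_neg_toMat, expA_neg, inv_inv]
  rw [mul_assoc, mul_inv_eq_iff_eq_mul.1 (hcomm t), inv_mul_cancel_left]

end RootBasis

end CartanData

/-! ### Comparison of the Riemannian distance and the norms with the operator norm -/

theorem exists_seminorm_eq_sqrt {V : Type*} [AddCommGroup V] [Module ℝ V]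
    (B : LinearMap.BilinForm ℝ V) (hsymm : ∀ x y, B x y = B y x)
    (hpos : ∀ x, x ≠ 0 → 0 < B x x) : ∃ p : Seminorm ℝ V, ∀ x, p x = Real.sqrt (B x x) := by
  let core : InnerProductSpace.Core ℝ V :=
    { inner := fun x y => B x y
      conj_inner_symm := fun x y => hsymm y x
      re_inner_nonneg := fun x => by
        by_cases hx : x = 0
        · simp [hx]
        · exact (hpos x hx).le
      add_left := fun x y z => by simp
      smul_left := fun x y r => by simp
      definite := fun x hx => by
        by_contra h
        exact (hpos x h).ne' hx }
  let : NormedAddCommGroup V := core.toNormedAddCommGroup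
  let : InnerProductSpace ℝ V := InnerProductSpace.ofCore core.toCore
  exact ⟨normSeminorm ℝ V, fun x => norm_eq_sqrt_real_inner x⟩

namespace MetricData

open scoped Matrix.Norms.Operator

variable {n : ℕ} {G : ClosedSubgroup (GL (Fin n) ℝ)} {D : CartanData G} (R : MetricData D)

/-- The operator norm as a seminorm on a subspace of matrices. -/
def opSeminorm (F : Submodule ℝ (RMat n)) : Seminorm ℝ F := (normSeminorm ℝ (RMat n)).comp F.subtype

theorem exists_ip_le : ∃ C : ℝ, 0 < C ∧ ∀ X : lieAlg G,
    Real.sqrt (R.ip X X) ≤ C * ‖(X : RMat n)‖ ∧ ‖(X : RMat n)‖ ≤ C * Real.sqrt (R.ip X X) := by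
  obtain ⟨p, hp⟩ := exists_seminorm_eq_sqrt R.ip R.ip_symm R.ip_pos
  obtain ⟨C₁, hC₁, h₁⟩ := exists_seminorm_le (opSeminorm (lieAlg G).toSubmodule) p
    (fun x hx => norm_pos_iff.2 fun h => hx (Subtype.ext h))
  obtain ⟨C₂, hC₂, h₂⟩ := exists_seminorm_le p (opSeminorm (lieAlg G).toSubmodule)
    (fun x hx => by rw [hp]; exact Real.sqrt_pos.2 (R.ip_pos x hx))
  refine ⟨max C₁ C₂, by positivity, fun X => ⟨?_, ?_⟩⟩
  · rw [← hp]
    refine (h₁ X).trans ?_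
    change C₁ * ‖(X : RMat n)‖ ≤ _
    gcongr
    exact le_max_left _ _
  · rw [← hp]
    refine (h₂ X).trans ?_
    have := apply_nonneg p X
    gcongr
    exact le_max_right _ _

theorem exists_normN_le : ∃ C : ℝ, 0 < C ∧ ∀ X : lieAlg D.N,
    R.normN X ≤ C * ‖(X : RMat n)‖ ∧ ‖(X : RMat n)‖ ≤ C * R.normN X := by
  obtain ⟨C₁, hC₁, h₁⟩ := exists_seminorm_le (opSeminorm (lieAlg D.N).toSubmodule) R.normN
    (fun x hx => norm_pos_iff.2 fun h => hx (Subtype.ext h))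
  obtain ⟨C₂, hC₂, h₂⟩ := exists_seminorm_le R.normN (opSeminorm (lieAlg D.N).toSubmodule)
    R.normN_pos
  refine ⟨max C₁ C₂, by positivity, fun X => ⟨?_, ?_⟩⟩
  · refine (h₁ X).trans ?_
    change C₁ * ‖(X : RMat n)‖ ≤ _
    gcongr
    exact le_max_left _ _
  · refine (h₂ X).trans ?_
    have := apply_nonneg R.normN X
    gcongr
    exact le_max_right _ _

theorem exists_normNp_le : ∃ C : ℝ, 0 < C ∧ ∀ X : lieAlg D.Np,
    R.normNp X ≤ C * ‖(X : RMat n)‖ ∧ ‖(X : RMat n)‖ ≤ C * R.normNp X := by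
  obtain ⟨C₁, hC₁, h₁⟩ := exists_seminorm_le (opSeminorm (lieAlg D.Np).toSubmodule) R.normNp
    (fun x hx => norm_pos_iff.2 fun h => hx (Subtype.ext h))
  obtain ⟨C₂, hC₂, h₂⟩ := exists_seminorm_le R.normNp (opSeminorm (lieAlg D.Np).toSubmodule)
    R.normNp_pos
  refine ⟨max C₁ C₂, by positivity, fun X => ⟨?_, ?_⟩⟩
  · refine (h₁ X).trans ?_
    change C₁ * ‖(X : RMat n)‖ ≤ _
    gcongr
    exact le_max_left _ _
  · refine (h₂ X).trans ?_
    have := apply_nonneg R.normNp X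
    gcongr
    exact le_max_right _ _

theorem continuousOn_sqrt_ip {v : ℝ → lieAlg G} (hv : ContinuousOn v (Set.Icc 0 1)) :
    ContinuousOn (fun t => Real.sqrt (R.ip (v t) (v t))) (Set.Icc 0 1) := by
  obtain ⟨p, hp⟩ := CartanData.RootBasis.exists_linear_retraction G
  let b := Module.finBasis ℝ (lieAlg G)
  have hco : ∀ i, ContinuousOn (fun t => b.repr (v t) i) (Set.Icc 0 1) := fun i => by
    have h1 : Continuous ((b.coord i) ∘ₗ p) := LinearMap.continuous_of_finiteDimensional _
    refine (h1.comp_continuousOn (continuous_subtype_val.comp_continuousOn hv)).congr fun t _ => ?_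
    simp [hp]
  refine Real.continuous_sqrt.comp_continuousOn ?_
  have h2 : ∀ X : lieAlg G, R.ip X X = ∑ i, ∑ j, b.repr X i * (b.repr X j * R.ip (b i) (b j)) := by
    intro X
    conv_lhs => rw [← b.sum_repr X]
    simp only [map_sum, LinearMap.sum_apply, map_smul, LinearMap.smul_apply, smul_eq_mul,
      Finset.mul_sum]
    rw [Finset.sum_comm]
    refine Finset.sum_congr rfl fun i _ => Finset.sum_congr rfl fun j _ => by ring
  simp only [h2]
  exact continuousOn_finsetSum _ fun i _ => continuousOn_finsetSum _ fun j _ =>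
    (hco i).mul ((hco j).mul continuousOn_const)

/-- Let `M` be the maximum of `‖c t - 1‖` along a curve `c` from `1` to `g` of length less than `ε`.
Integrating `c' = c v` gives `M ≤ (1 + M) C ε`, with the `C` of `exists_ip_le`, and `2 C ε ≤ 1` lets
the term `M C ε` be absorbed. -/
theorem exists_norm_sub_one_le_of_riemDist_lt : ∃ C : ℝ, 0 < C ∧ ∀ ε : ℝ, C * ε ≤ 1 →
    ∀ g : GL (Fin n) ℝ, R.riemDist 1 g < ENNReal.ofReal ε → ‖(g : RMat n) - 1‖ ≤ C * ε := by
  obtain ⟨C, hC, hip⟩ := R.exists_ip_le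
  refine ⟨2 * C, by positivity, fun ε hε g hg => ?_⟩
  simp only [riemDist, iInf_lt_iff] at hg
  obtain ⟨c, v, hcv, h0, h1, hlen⟩ := hg
  have hlen' := (ENNReal.ofReal_lt_ofReal_iff'.1 hlen).1
  set f : ℝ → RMat n := fun t => (c t : RMat n) with hf
  have hd : ∀ t ∈ Set.Icc (0 : ℝ) 1,
      HasDerivWithinAt f ((c t : RMat n) * (v t : RMat n)) (Set.Icc 0 1) t := fun t ht =>
    hasDerivWithinAt_pi.2 fun i => hasDerivWithinAt_pi.2 fun j => hcv.hasDeriv t ht i j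
  have hfc : ContinuousOn f (Set.Icc 0 1) := fun t ht => (hd t ht).continuousWithinAt
  have hvc : ContinuousOn (fun t => (v t : RMat n)) (Set.Icc 0 1) :=
    continuous_subtype_val.comp_continuousOn hcv.continuousOn
  obtain ⟨t, ht, hmax⟩ := isCompact_Icc.exists_isMaxOn (Set.nonempty_Icc.2 (zero_le_one (α := ℝ)))
    (hfc.sub (continuousOn_const (c := (1 : RMat n)))).norm
  have hmax' : ∀ s ∈ Set.Icc (0 : ℝ) 1, ‖f s - 1‖ ≤ ‖f t - 1‖ := fun s hs => hmax hs
  set M := ‖f t - 1‖ with hM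
  have hM0 : 0 ≤ M := norm_nonneg _
  have hsub : Set.Icc 0 t ⊆ Set.Icc (0 : ℝ) 1 := Set.Icc_subset_Icc_right ht.2
  have hcont : ContinuousOn (fun s => f s * (v s : RMat n)) (Set.Icc 0 1) := hfc.mul hvc
  have hsq := R.continuousOn_sqrt_ip hcv.continuousOn
  have hftc : ∫ s in (0 : ℝ)..t, f s * (v s : RMat n) = f t - f 0 :=
    intervalIntegral.integral_eq_sub_of_hasDerivAt_of_le ht.1 (hfc.mono hsub)
      (fun s hs => (hd s (hsub (Set.Ioo_subset_Icc_self hs))).hasDerivAt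
        (Icc_mem_nhds hs.1 (hs.2.trans_le ht.2)))
      ((hcont.mono hsub).intervalIntegrable_of_Icc ht.1)
  have hf0 : f 0 = 1 := by simp [hf, h0]
  have hpt : ∀ s ∈ Set.Icc (0 : ℝ) 1,
      ‖f s * (v s : RMat n)‖ ≤ (1 + M) * C * Real.sqrt (R.ip (v s) (v s)) := by
    intro s hs
    have e : f s * (v s : RMat n) = (f s - 1) * (v s : RMat n) + (v s : RMat n) := by
      rw [sub_mul, one_mul]; abel
    calc _ ≤ ‖f s - 1‖ * ‖(v s : RMat n)‖ + ‖(v s : RMat n)‖ := by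
          rw [e]
          exact (norm_add_le _ _).trans (by gcongr; exact norm_mul_le _ _)
      _ ≤ M * ‖(v s : RMat n)‖ + ‖(v s : RMat n)‖ := by gcongr; exact hmax' s hs
      _ = (1 + M) * ‖(v s : RMat n)‖ := by ring
      _ ≤ (1 + M) * (C * Real.sqrt (R.ip (v s) (v s))) := by gcongr; exact (hip _).2
      _ = _ := by ring
  have hint := hsq.intervalIntegrable_of_Icc (μ := MeasureTheory.volume) (zero_le_one (α := ℝ))
  have hint' := (hsq.mono hsub).intervalIntegrable_of_Icc (μ := MeasureTheory.volume) ht.1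
  have hMle : M ≤ (1 + M) * C * ε := by
    calc M = ‖∫ s in (0 : ℝ)..t, f s * (v s : RMat n)‖ := by rw [hftc, hf0]
      _ ≤ ∫ s in (0 : ℝ)..t, ‖f s * (v s : RMat n)‖ :=
          intervalIntegral.norm_integral_le_integral_norm ht.1
      _ ≤ ∫ s in (0 : ℝ)..t, (1 + M) * C * Real.sqrt (R.ip (v s) (v s)) :=
          intervalIntegral.integral_mono_on ht.1
            ((hcont.norm.mono hsub).intervalIntegrable_of_Icc ht.1) (hint'.const_mul _)
            fun s hs => hpt s (hsub hs)
      _ = (1 + M) * C * ∫ s in (0 : ℝ)..t, Real.sqrt (R.ip (v s) (v s)) :=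
          intervalIntegral.integral_const_mul _ _
      _ ≤ (1 + M) * C * ∫ s in (0 : ℝ)..1, Real.sqrt (R.ip (v s) (v s)) := by
          gcongr
          exact intervalIntegral.integral_mono_interval le_rfl ht.1 ht.2
            (Eventually.of_forall fun s => Real.sqrt_nonneg _) hint
      _ ≤ (1 + M) * C * ε := by gcongr
  have hg1 : ‖(g : RMat n) - 1‖ ≤ M := by
    have := hmax' 1 (Set.right_mem_Icc.2 zero_le_one)
    simpa [hf, h1] using this
  nlinarith

/-- The curve `exp(tZ₁) exp(tZ₂) g exp(tZ₃)` has, after left translation to the identity, exactly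
the velocity bounded by `L`. -/
theorem exists_riemDist_le : ∃ C : ℝ, 0 < C ∧ ∀ g ∈ G, ∀ Z₁ ∈ lieSubspace G, ∀ Z₂ ∈ lieSubspace G,
    ∀ Z₃ ∈ lieSubspace G, ∀ L : ℝ,
    (∀ t : ℝ, ‖conjL (expGL (t • Z₂) * g * expGL (t • Z₃))⁻¹ Z₁ + conjL (g * expGL (t • Z₃))⁻¹ Z₂
      + Z₃‖ ≤ L) → R.riemDist g (expGL Z₁ * expGL Z₂ * g * expGL Z₃) ≤ ENNReal.ofReal (C * L) := by
  obtain ⟨C, hC, hip⟩ := R.exists_ip_le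
  refine ⟨C, hC, fun g hg Z₁ hZ₁ Z₂ hZ₂ Z₃ hZ₃ L hL => ?_⟩
  set c : ℝ → GL (Fin n) ℝ := fun t => expGL (t • Z₁) * expGL (t • Z₂) * g * expGL (t • Z₃) with hc
  have hmem : ∀ t, conjL (expGL (t • Z₂) * g * expGL (t • Z₃))⁻¹ Z₁ +
      conjL (g * expGL (t • Z₃))⁻¹ Z₂ + Z₃ ∈ lieSubspace G := fun t =>
    Submodule.add_mem _ (Submodule.add_mem _
      (lieSubspace_conj G (inv_mem (mul_mem (mul_mem (hZ₂ t) hg) (hZ₃ t))) hZ₁)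
      (lieSubspace_conj G (inv_mem (mul_mem hg (hZ₃ t))) hZ₂)) hZ₃
  set v : ℝ → lieAlg G := fun t => ⟨_, hmem t⟩ with hv
  have hexp : ∀ Z : RMat n, Continuous fun t : ℝ => expGL (t • Z) := fun Z =>
    continuous_expGL.comp (continuous_id.smul continuous_const)
  have hconj : ∀ (u : ℝ → GL (Fin n) ℝ) (Z : RMat n), Continuous u →
      Continuous fun t => conjL (u t)⁻¹ Z := fun u Z hu =>
    ((Units.continuous_val.comp (continuous_inv.comp hu)).mul continuous_const).mul
      (Units.continuous_val.comp (continuous_inv.comp (continuous_inv.comp hu)))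
  have hcurve : IsC1Curve G c v := by
    refine ⟨fun t _ => mul_mem (mul_mem (mul_mem (hZ₁ t) (hZ₂ t)) hg) (hZ₃ t), ?_, ?_⟩
    · refine (continuous_induced_rng.2 ?_).continuousOn
      exact ((hconj _ Z₁ (((hexp Z₂).mul continuous_const).mul (hexp Z₃))).add
        (hconj _ Z₂ (continuous_const.mul (hexp Z₃)))).add continuous_const
    · intro t _ i j
      have h1 := hasDerivAt_exp_smul_const (𝕂 := ℝ) Z₁ t
      have h2 := hasDerivAt_exp_smul_const (𝕂 := ℝ) Z₂ t
      have h3 := hasDerivAt_exp_smul_const (𝕂 := ℝ) Z₃ t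
      have h4 := ((h1.mul h2).mul_const (g : RMat n)).mul h3
      have h5 : (c t : RMat n) * (v t : RMat n) =
          (NormedSpace.exp (t • Z₁) * Z₁ * NormedSpace.exp (t • Z₂) +
            NormedSpace.exp (t • Z₁) * (NormedSpace.exp (t • Z₂) * Z₂)) * (g : RMat n) *
            NormedSpace.exp (t • Z₃) +
          NormedSpace.exp (t • Z₁) * NormedSpace.exp (t • Z₂) * (g : RMat n) *
            (NormedSpace.exp (t • Z₃) * Z₃) := by
        have e1 : (c t : RMat n) * conjL (expGL (t • Z₂) * g * expGL (t • Z₃))⁻¹ Z₁ =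
            (expGL (t • Z₁) : RMat n) * Z₁ *
              ((expGL (t • Z₂) * g * expGL (t • Z₃) : GL (Fin n) ℝ) : RMat n) := by
          have : c t = expGL (t • Z₁) * (expGL (t • Z₂) * g * expGL (t • Z₃)) := by
            rw [hc]; group
          rw [this, Units.val_mul, conjL_apply, inv_inv, mul_assoc (expGL (t • Z₁) : RMat n),
            ← mul_assoc, ← mul_assoc, ← mul_assoc, mul_assoc (expGL (t • Z₁) : RMat n),
            Units.mul_inv, mul_one]
        have e2 : (c t : RMat n) * conjL (g * expGL (t • Z₃))⁻¹ Z₂ =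
            (expGL (t • Z₁) : RMat n) * (expGL (t • Z₂) : RMat n) * Z₂ *
              ((g * expGL (t • Z₃) : GL (Fin n) ℝ) : RMat n) := by
          have : c t = expGL (t • Z₁) * expGL (t • Z₂) * (g * expGL (t • Z₃)) := by
            rw [hc]; group
          rw [this, Units.val_mul, conjL_apply, inv_inv, Units.val_mul (expGL (t • Z₁)),
            mul_assoc (_ * _), ← mul_assoc _ _ (((g * expGL (t • Z₃) : GL (Fin n) ℝ)) : RMat n),
            ← mul_assoc _ _ Z₂, Units.mul_inv, one_mul]
          simp only [mul_assoc]
        change (c t : RMat n) * (conjL (expGL (t • Z₂) * g * expGL (t • Z₃))⁻¹ Z₁ +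
          conjL (g * expGL (t • Z₃))⁻¹ Z₂ + Z₃) = _
        rw [mul_add, mul_add, e1, e2]
        simp only [hc, Units.val_mul, expGL_val, add_mul, mul_assoc]
      rw [h5]
      exact ((hasDerivAt_pi.1 (hasDerivAt_pi.1 h4 i)) j).hasDerivWithinAt
  have hcle : R.riemDist g (expGL Z₁ * expGL Z₂ * g * expGL Z₃) ≤
      ENNReal.ofReal (∫ t in (0 : ℝ)..1, Real.sqrt (R.ip (v t) (v t))) :=
    iInf_le_of_le c <| iInf_le_of_le v <| iInf_le_of_le hcurve <|
      iInf_le_of_le (by simp [hc, expGL_zero]) <| iInf_le_of_le (by simp [hc]) le_rfl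
  refine hcle.trans (ENNReal.ofReal_le_ofReal ?_)
  have hb := intervalIntegral.norm_integral_le_of_norm_le_const (a := (0 : ℝ)) (b := 1) (C := C * L)
    (f := fun t => Real.sqrt (R.ip (v t) (v t))) (fun t _ => by
      rw [Real.norm_of_nonneg (Real.sqrt_nonneg _)]
      exact (hip _).1.trans (by gcongr; exact hL t))
  rw [sub_zero, abs_one, mul_one] at hb
  exact (le_abs_self _).trans hb

end MetricData

/-! ### Local decompositions of `G`, plain and twisted -/

namespace CartanData

namespace RootBasis

open scoped Matrix.Norms.Operator

variable {n : ℕ} {G : ClosedSubgroup (GL (Fin n) ℝ)} {D : CartanData G}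

theorem lieSubspace_Np_le : lieSubspace D.Np ≤ lieSubspace G := fun _ hX t => (hX t).1

theorem lieSubspace_N_le : lieSubspace D.N ≤ lieSubspace G := fun _ hX t => (hX t).1

theorem toMat_mem (w : D.𝔞) : D.toMat w ∈ lieSubspace G := (w : lieAlg G).2

theorem πa_mem_lieSubspace (E : D.RootBasis) (u : RMat n) : E.πa u ∈ lieSubspace G := by
  obtain ⟨w, hw⟩ := E.πa_mem u
  rw [hw]
  exact toMat_mem w

theorem exists_bound_π (E : D.RootBasis) : ∃ C : ℝ, 0 < C ∧ ∀ u : RMat n,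
    ‖E.πp u‖ ≤ C * ‖u‖ ∧ ‖E.πm u‖ ≤ C * ‖u‖ ∧ ‖E.πa u‖ ≤ C * ‖u‖ ∧ ‖E.πk u‖ ≤ C * ‖u‖ := by
  obtain ⟨c₁, h₁, k₁⟩ := exists_forall_norm_apply_le E.πp
  obtain ⟨c₂, h₂, k₂⟩ := exists_forall_norm_apply_le E.πm
  obtain ⟨c₃, h₃, k₃⟩ := exists_forall_norm_apply_le E.πa
  obtain ⟨c₄, h₄, k₄⟩ := exists_forall_norm_apply_le E.πk
  refine ⟨c₁ + c₂ + c₃ + c₄, by positivity, fun u => ⟨(k₁ u).trans ?_, (k₂ u).trans ?_,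
    (k₃ u).trans ?_, (k₄ u).trans ?_⟩⟩ <;> gcongr <;> linarith

/-- Local decomposition `N⁺ N A M` of `G` near `1`. -/
theorem exists_decomp_Np (E : D.RootBasis) : ∃ δ : ℝ, 0 < δ ∧ ∃ C : ℝ, 0 < C ∧ ∀ k ∈ G,
    ‖(k : RMat n) - 1‖ ≤ δ → ∃ X ∈ lieSubspace D.Np, ∃ Y ∈ lieSubspace D.N, ∃ (w : D.𝔞) (Z : RMat n),
      D.IsMTangent Z ∧ k = expGL X * expGL Y * (D.expA w * expGL Z) ∧
      ‖X‖ ≤ C * ‖(k : RMat n) - 1‖ ∧ ‖Z‖ ≤ C * ‖(k : RMat n) - 1‖ := by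
  obtain ⟨c, hc, hb⟩ := E.exists_bound_π
  obtain ⟨δ, hδ, C, hC, h⟩ := exists_eq_prod_expGL G [(0 : Fin 4), 1, 2, 3] c
  refine ⟨δ, hδ, c * C, by positivity, fun k hk hkδ => ?_⟩
  obtain ⟨u, -, hu, hku⟩ := h ![E.πp, E.πm, E.πa, E.πk]
    (by
      intro i u
      obtain ⟨h1, h2, h3, h4⟩ := hb u
      fin_cases i
      · exact h1
      · exact h2
      · exact h3
      · exact h4)
    (by
      intro i u _
      fin_cases i
      · exact lieSubspace_Np_le (E.πp_mem u)
      · exact lieSubspace_N_le (E.πm_mem u)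
      · exact E.πa_mem_lieSubspace u
      · exact (E.πk_mem u).1)
    (by
      intro u hu
      have := E.sum_π hu
      simpa [add_assoc] using this) k hk hkδ
  obtain ⟨h1, h2, h3, h4⟩ := hb u
  obtain ⟨w, hw⟩ := E.πa_mem u
  have hle : c * ‖u‖ ≤ c * C * ‖(k : RMat n) - 1‖ := by
    rw [mul_assoc]; gcongr
  refine ⟨E.πp u, E.πp_mem u, E.πm u, E.πm_mem u, w, E.πk u, E.πk_mem u, ?_,
    h1.trans hle, h4.trans hle⟩
  rw [hku, expA, ← hw]
  simp [mul_assoc]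

/-- Local decomposition `N N⁺ A M` of `G` near `1`. -/
theorem exists_decomp_N (E : D.RootBasis) : ∃ δ : ℝ, 0 < δ ∧ ∃ C : ℝ, 0 < C ∧ ∀ k ∈ G,
    ‖(k : RMat n) - 1‖ ≤ δ → ∃ Y ∈ lieSubspace D.N, ∃ p ∈ D.Pp, k = expGL Y * p ∧
      ‖Y‖ ≤ C * ‖(k : RMat n) - 1‖ := by
  obtain ⟨c, hc, hb⟩ := E.exists_bound_π
  obtain ⟨δ, hδ, C, hC, h⟩ := exists_eq_prod_expGL G [(0 : Fin 4), 1, 2, 3] c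
  refine ⟨δ, hδ, c * C, by positivity, fun k hk hkδ => ?_⟩
  obtain ⟨u, -, hu, hku⟩ := h ![E.πm, E.πp, E.πa, E.πk]
    (by
      intro i u
      obtain ⟨h1, h2, h3, h4⟩ := hb u
      fin_cases i
      · exact h2
      · exact h1
      · exact h3
      · exact h4)
    (by
      intro i u _
      fin_cases i
      · exact lieSubspace_N_le (E.πm_mem u)
      · exact lieSubspace_Np_le (E.πp_mem u)
      · exact E.πa_mem_lieSubspace u
      · exact (E.πk_mem u).1)
    (by
      intro u hu
      have := E.sum_π hu
      rw [add_comm (E.πp u)] at this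
      simpa [add_assoc] using this) k hk hkδ
  obtain ⟨h1, h2, h3, h4⟩ := hb u
  obtain ⟨w, hw⟩ := E.πa_mem u
  have hle : c * ‖u‖ ≤ c * C * ‖(k : RMat n) - 1‖ := by
    rw [mul_assoc]; gcongr
  refine ⟨E.πm u, E.πm_mem u, expGL (E.πp u) * (D.expA w * expGL (E.πk u)),
    ⟨_, expGL_mem (E.πp_mem u), _, ⟨w, _, (E.πk_mem u).expGL_mem, rfl⟩, rfl⟩, ?_, h2.trans hle⟩
  rw [hku, expA, ← hw]
  simp

/-- The source of the threshold `T ≥ 1`: the Neumann series below have ratio at most `1/2`. -/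
theorem exp_neg_le_half {T : ℝ} (hT : 1 ≤ T) : Real.exp (-T) ≤ 1 / 2 := by
  have h1 : (2 : ℝ) ≤ Real.exp T := by
    have := Real.add_one_le_exp T
    linarith
  rw [Real.exp_neg, inv_eq_one_div]
  exact one_div_le_one_div_of_le two_pos h1

/-- Take `ρ = ∑_{j ≥ 1} σ^j π` with `σ = conjL (D.expA w * m)` and `π = E.proj s`. Starting at `j =
1` gives the factor `e^{-T}`, and shifting the sum gives `ρ = σ(π + ρ)`. -/
theorem exists_neumann_conjL (E : D.RootBasis) (s) (F : Submodule ℝ (RMat n))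
    (hs : ∀ u, (E.proj s u : RMat n) ∈ F) : ∃ C : ℝ, 0 < C ∧ ∀ (w : D.𝔞) (T : ℝ), 1 ≤ T →
    (∀ i ∈ s, E.χ i w ≤ -T) → ∀ m ∈ D.M, (∀ X ∈ F, conjL (D.expA w * m) X ∈ F) →
      ∃ ρ : RMat n →ₗ[ℝ] RMat n, (∀ u, ρ u ∈ F) ∧ (∀ u, ‖ρ u‖ ≤ C * Real.exp (-T) * ‖u‖) ∧
        ∀ u, ρ u = conjL (D.expA w * m) ((E.proj s u : RMat n) + ρ u) := by
  obtain ⟨C, hC, h⟩ := E.exists_norm_conjL_pow_proj_le s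
  refine ⟨C * 2, by positivity, fun w T hT hw m hm hF => ?_⟩
  set σ := conjL (D.expA w * m) with hσ
  have hFj : ∀ (j : ℕ) (X : RMat n), X ∈ F → (σ ^ j) X ∈ F := by
    intro j
    induction j with
    | zero => intro X hX; simpa using hX
    | succ j ih =>
      intro X hX
      rw [pow_succ, Module.End.mul_apply]
      exact ih _ (hF X hX)
  have hq := exp_neg_le_half hT
  obtain ⟨ρ, h1, h2, h3⟩ := exists_neumann σ (σ ∘ₗ (lieAlg G).toSubmodule.subtype ∘ₗ E.proj s) F
    (C := C * Real.exp (-T)) (q := Real.exp (-T)) (Real.exp_pos _).le (by linarith)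
    (fun j u => hFj j _ (hF _ (hs u)))
    (fun j u => by
      have := h w T hw m hm (j + 1) u
      rw [pow_succ (conjL _), Module.End.mul_apply] at this
      refine this.trans (le_of_eq ?_)
      rw [pow_succ]; ring)
  refine ⟨ρ, h1, fun u => (h2 u).trans ?_, fun u => ?_⟩
  · have h4 : (1 - Real.exp (-T))⁻¹ ≤ 2 := by
      rw [inv_le_comm₀ (by linarith) two_pos]
      linarith
    have := (Real.exp_pos (-T)).le
    calc C * Real.exp (-T) * (1 - Real.exp (-T))⁻¹ * ‖u‖ ≤ C * Real.exp (-T) * 2 * ‖u‖ := by gcongr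
      _ = _ := by ring
  · rw [map_add]
    exact h3 u

/-- Solution of `k = h c (b h b⁻¹)⁻¹` with `h` in `N⁺ N` and `c` in `A M`, for `b` in `A M`
contracting `N⁺` and expanding `N`. -/
theorem exists_twisted_decomp (E : D.RootBasis) : ∃ δ : ℝ, 0 < δ ∧ ∃ C : ℝ, 0 < C ∧
    ∀ (w : D.𝔞) (T : ℝ), 1 ≤ T → (∀ α, D.IsPositiveRoot α → T ≤ α w) → ∀ m ∈ D.M, ∀ k ∈ G,
    ‖(k : RMat n) - 1‖ ≤ δ → ∃ X ∈ lieSubspace D.Np, ∃ S ∈ lieSubspace D.N,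
    ∃ (v : D.𝔞) (Z : RMat n), D.IsMTangent Z ∧
      k = expGL X * expGL S * (D.expA v * expGL Z) *
        ((D.expA w * m) * (expGL X * expGL S) * (D.expA w * m)⁻¹)⁻¹ ∧
      ‖X‖ ≤ C * ‖(k : RMat n) - 1‖ ∧
      ‖conjL (D.expA w * m) X‖ ≤ C * Real.exp (-T) * ‖(k : RMat n) - 1‖ ∧
      ‖S‖ ≤ C * Real.exp (-T) * ‖(k : RMat n) - 1‖ ∧
      ‖D.toMat v‖ ≤ C * ‖(k : RMat n) - 1‖ ∧ ‖Z‖ ≤ C * ‖(k : RMat n) - 1‖ := by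
  obtain ⟨c, hc, hb⟩ := E.exists_bound_π
  obtain ⟨c₁, hc₁, hN₁⟩ := E.exists_neumann_conjL E.negIdx (lieSubspace D.Np) E.πp_mem
  obtain ⟨c₂, hc₂, hN₂⟩ := E.exists_neumann_conjL E.posIdx (lieSubspace D.N) E.πm_mem
  obtain ⟨δ, hδ, C, hC, h⟩ := exists_eq_prod_expGL G [(0 : Fin 6), 1, 2, 3, 4, 5] (c + c₁ + c₂)
  refine ⟨δ, hδ, (c + c₁ + c₂) * C, by positivity, fun w T hT hw m hm k hk hkδ => ?_⟩
  set b := D.expA w * m with hbdef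
  have hbAM : b ∈ D.AMSubgroup := ⟨w, m, hm, rfl⟩
  have hinv : D.expA (-w) * m⁻¹ = b⁻¹ := by
    rw [hbdef, _root_.mul_inv_rev, expA_neg, (commute_of_mem_M hm w).inv_left.inv_right.eq]
  obtain ⟨ρ₁, hρ₁, hρ₁b, hρ₁e⟩ := hN₁ w T hT (fun i hi => by
    have := hw _ (E.isPositiveRoot_neg i (by simpa [negIdx] using hi))
    rw [LinearMap.neg_apply] at this
    linarith) m hm (fun X hX => conjL_mem_lieSubspace (fun g hg => conj_mem_Np hbAM hg) hX)
  -- On `𝔫` it is `b⁻¹` that contracts, so the series is taken for `-w` and `m⁻¹`.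
  obtain ⟨ρ₂, hρ₂, hρ₂b, hρ₂e⟩ := hN₂ (-w) T hT (fun i hi => by
    have := hw _ (E.isPositiveRoot i (by simpa [posIdx] using hi))
    rw [map_neg]
    linarith) m⁻¹ (D.MSubgroup.inv_mem hm) (fun X hX => by
      rw [hinv]
      exact conjL_mem_lieSubspace (fun g hg => conj_mem_N (inv_mem hbAM) hg) hX)
  rw [hinv] at hρ₂e
  have hq : Real.exp (-T) ≤ 1 := (exp_neg_le_half hT).trans (by norm_num)
  have hq0 := (Real.exp_pos (-T)).le
  have hρ₁b' : ∀ u, ‖ρ₁ u‖ ≤ c₁ * ‖u‖ := fun u => (hρ₁b u).trans (by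
    have : c₁ * Real.exp (-T) ≤ c₁ := mul_le_of_le_one_right hc₁.le hq
    gcongr)
  have hρ₂b' : ∀ u, ‖ρ₂ u‖ ≤ c₂ * ‖u‖ := fun u => (hρ₂b u).trans (by
    have : c₂ * Real.exp (-T) ≤ c₂ := mul_le_of_le_one_right hc₂.le hq
    gcongr)
  -- The six exponents are `X`, `S`, the `𝔞` and `𝔪` parts of `c`, then `-Ad b S` and `-Ad b X`,
  -- where `X = πp u + ρ₁ u` and `S = -ρ₂ u`. The `ρ` terms cancel in the sum, which is therefore
  -- the identity on `𝔤`.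
  obtain ⟨u, -, hu, hku⟩ := h ![E.πp + ρ₁, -ρ₂, E.πa, E.πk, E.πm + ρ₂, -ρ₁]
    (by
      intro i u
      obtain ⟨h1, h2, h3, h4⟩ := hb u
      have h5 := hρ₁b' u
      have h6 := hρ₂b' u
      have h7 := norm_nonneg u
      have h8 := norm_add_le (E.πp u) (ρ₁ u)
      have h9 := norm_add_le (E.πm u) (ρ₂ u)
      have k0 := mul_nonneg hc.le h7
      have k1 := mul_nonneg hc₁.le h7
      have k2 := mul_nonneg hc₂.le h7
      rw [add_mul, add_mul]
      fin_cases i <;> simp <;> linarith)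
    (by
      intro i u _
      have h1 := lieSubspace_Np_le (hρ₁ u)
      have h2 := lieSubspace_N_le (hρ₂ u)
      fin_cases i
      · exact Submodule.add_mem _ (lieSubspace_Np_le (E.πp_mem u)) h1
      · exact Submodule.neg_mem _ h2
      · exact E.πa_mem_lieSubspace u
      · exact (E.πk_mem u).1
      · exact Submodule.add_mem _ (lieSubspace_N_le (E.πm_mem u)) h2
      · exact Submodule.neg_mem _ h1)
    (by
      intro u hu
      have := E.sum_π hu
      conv_rhs => rw [← this]
      simp
      abel) k hk hkδ
  obtain ⟨h1, h2, h3, h4⟩ := hb u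
  obtain ⟨v, hv⟩ := E.πa_mem u
  have hX : conjL b (E.πp u + ρ₁ u) = ρ₁ u := (hρ₁e u).symm
  have hS : conjL b (-ρ₂ u) = -(E.πm u + ρ₂ u) := by
    rw [map_neg, hρ₂e u, ← conjL_mul, mul_inv_cancel, conjL_one]
    change -((E.proj E.posIdx u : RMat n) + ρ₂ u) = -((E.proj E.posIdx u : RMat n) + conjL b⁻¹ _)
    rw [← hρ₂e u]
  have hν := norm_nonneg ((k : RMat n) - 1)
  have hbound : ∀ x c' : ℝ, 0 ≤ c' → c' ≤ c + c₁ + c₂ → x ≤ c' * ‖u‖ →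
      x ≤ (c + c₁ + c₂) * C * ‖(k : RMat n) - 1‖ := fun x c' h0 hc' hx => hx.trans (by
    rw [mul_assoc]; gcongr)
  have hbound' : ∀ x c' : ℝ, 0 ≤ c' → c' ≤ c + c₁ + c₂ → x ≤ c' * Real.exp (-T) * ‖u‖ →
      x ≤ (c + c₁ + c₂) * C * Real.exp (-T) * ‖(k : RMat n) - 1‖ := fun x c' h0 hc' hx => hx.trans (by
    calc c' * Real.exp (-T) * ‖u‖ ≤
        (c + c₁ + c₂) * Real.exp (-T) * (C * ‖(k : RMat n) - 1‖) := by gcongr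
      _ = _ := by ring)
  refine ⟨E.πp u + ρ₁ u, Submodule.add_mem _ (E.πp_mem u) (hρ₁ u), -ρ₂ u,
    Submodule.neg_mem _ (hρ₂ u), v, E.πk u, E.πk_mem u, ?_, ?_, ?_, ?_, ?_, ?_⟩
  · have e : b * (expGL (E.πp u + ρ₁ u) * expGL (-ρ₂ u)) * b⁻¹ =
        expGL (ρ₁ u) * expGL (-(E.πm u + ρ₂ u)) := by
      rw [← hS]
      conv_rhs => rw [← hX]
      rw [expGL_conjL, expGL_conjL]; group
    rw [e, _root_.mul_inv_rev, ← expGL_neg, ← expGL_neg, neg_neg, hku, expA, ← hv]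
    simp [mul_assoc]
  · refine hbound _ (c + c₁) (by positivity) (by linarith) ((norm_add_le _ _).trans ?_)
    have := hρ₁b' u
    rw [add_mul]; linarith
  · rw [hX]
    exact hbound' _ c₁ hc₁.le (by linarith) (hρ₁b u)
  · rw [norm_neg]
    exact hbound' _ c₂ hc₂.le (by linarith) (hρ₂b u)
  · rw [← hv]
    exact hbound _ c hc.le (by linarith) h3
  · exact hbound _ c hc.le (by linarith) h4

end RootBasis

end CartanData

/-! ### Estimates near the identity -/

section NearOne

open scoped Matrix.Norms.Operator

variable {n : ℕ}

theorem norm_mul_sub_one_le {g h : GL (Fin n) ℝ} {r s : ℝ} (hg : ‖(g : RMat n) - 1‖ ≤ r)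
    (hh : ‖(h : RMat n) - 1‖ ≤ s) (hr : r ≤ 1) :
    ‖((g * h : GL (Fin n) ℝ) : RMat n) - 1‖ ≤ r + 2 * s := by
  have e : ((g * h : GL (Fin n) ℝ) : RMat n) - 1 =
      ((g : RMat n) - 1) * ((h : RMat n) - 1) + ((g : RMat n) - 1) + ((h : RMat n) - 1) := by
    rw [Units.val_mul]; noncomm_ring
  have h1 : ‖((g : RMat n) - 1) * ((h : RMat n) - 1)‖ ≤ 1 * s :=
    (norm_mul_le _ _).trans (by gcongr; exact hg.trans hr)
  rw [e]
  have := norm_add₃_le (a := ((g : RMat n) - 1) * ((h : RMat n) - 1)) (b := (g : RMat n) - 1)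
    (c := (h : RMat n) - 1)
  linarith

theorem norm_inv_sub_one_le {g : GL (Fin n) ℝ} {r : ℝ} (hg : ‖(g : RMat n) - 1‖ ≤ r)
    (hr : r ≤ 1 / 2) : ‖((g⁻¹ : GL (Fin n) ℝ) : RMat n) - 1‖ ≤ 2 * r := by
  have e : ((g⁻¹ : GL (Fin n) ℝ) : RMat n) - 1 =
      -(((g : RMat n) - 1) * (((g⁻¹ : GL (Fin n) ℝ) : RMat n) - 1) + ((g : RMat n) - 1)) := by
    have h1 : (g : RMat n) * ((g⁻¹ : GL (Fin n) ℝ) : RMat n) = 1 := Units.mul_inv g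
    rw [sub_mul, mul_sub, h1]; noncomm_ring
  have h1 : ‖((g⁻¹ : GL (Fin n) ℝ) : RMat n) - 1‖ ≤
      1 / 2 * ‖((g⁻¹ : GL (Fin n) ℝ) : RMat n) - 1‖ + r := by
    conv_lhs => rw [e, norm_neg]
    refine (norm_add_le _ _).trans (add_le_add ((norm_mul_le _ _).trans ?_) hg)
    gcongr
    exact hg.trans hr
  linarith

theorem norm_conj_sub_one_le {g h : GL (Fin n) ℝ} (hg : ‖(g : RMat n) - 1‖ ≤ 1 / 2) :
    ‖((g * h * g⁻¹ : GL (Fin n) ℝ) : RMat n) - 1‖ ≤ 3 * ‖(h : RMat n) - 1‖ := by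
  have h1 := norm_inv_sub_one_le hg le_rfl
  have e : ((g * h * g⁻¹ : GL (Fin n) ℝ) : RMat n) - 1 =
      (g : RMat n) * ((h : RMat n) - 1) * ((g⁻¹ : GL (Fin n) ℝ) : RMat n) := by
    rw [mul_sub, sub_mul, mul_one, Units.mul_inv, Units.val_mul, Units.val_mul]
  set E := (h : RMat n) - 1
  have h2 : ‖(g : RMat n) * E‖ ≤ 3 / 2 * ‖E‖ := by
    have : (g : RMat n) * E = ((g : RMat n) - 1) * E + E := by noncomm_ring
    rw [this]
    have h3 : ‖((g : RMat n) - 1) * E‖ ≤ 1 / 2 * ‖E‖ := (norm_mul_le _ _).trans (by gcongr)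
    linarith [norm_add_le (((g : RMat n) - 1) * E) E]
  set F := (g : RMat n) * E
  have h4 : F * ((g⁻¹ : GL (Fin n) ℝ) : RMat n) =
      F * (((g⁻¹ : GL (Fin n) ℝ) : RMat n) - 1) + F := by noncomm_ring
  have h5 : ‖F * (((g⁻¹ : GL (Fin n) ℝ) : RMat n) - 1)‖ ≤ ‖F‖ * (2 * (1 / 2)) :=
    (norm_mul_le _ _).trans (by gcongr)
  rw [e, h4]
  linarith [norm_add_le (F * (((g⁻¹ : GL (Fin n) ℝ) : RMat n) - 1)) F]

theorem exists_norm_sub_le_expGL (n : ℕ) : ∃ δ : ℝ, 0 < δ ∧ ∀ X X' : RMat n, ‖X‖ ≤ δ → ‖X'‖ ≤ δ →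
    ‖X - X'‖ ≤ 2 * ‖(expGL X : RMat n) - (expGL X' : RMat n)‖ ∧
    ‖(expGL X : RMat n) - (expGL X' : RMat n)‖ ≤ 2 * ‖X - X'‖ :=
  exists_norm_sub_le_exp (RMat n)

theorem exists_norm_expGL_sub_one_le (n : ℕ) : ∃ δ : ℝ, 0 < δ ∧ ∀ X : RMat n, ‖X‖ ≤ δ →
    ‖(expGL X : RMat n) - 1‖ ≤ 2 * ‖X‖ := by
  obtain ⟨δ, hδ, h⟩ := exists_norm_sub_le_expGL n
  refine ⟨δ, hδ, fun X hX => ?_⟩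
  have := (h X 0 hX (by simpa using hδ.le)).2
  rwa [expGL_zero, sub_zero] at this

/-- Smallness conditions on `ε` are collected as eventual statements and extracted together. -/
theorem eventually_mul_le (C : ℝ) {δ : ℝ} (hδ : 0 < δ) : ∀ᶠ ε : ℝ in 𝓝[>] 0, C * ε ≤ δ := by
  have h : Tendsto (fun ε : ℝ => C * ε) (𝓝[>] 0) (𝓝 0) := by
    have := (continuous_const_mul C).tendsto (0 : ℝ)
    rw [mul_zero] at this
    exact this.mono_left nhdsWithin_le_nhds
  exact h.eventually_le_const hδ

theorem exists_pos_forall_lt_of_eventually {P : ℝ → Prop} (h : ∀ᶠ ε : ℝ in 𝓝[>] 0, P ε) :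
    ∃ ε₁ : ℝ, 0 < ε₁ ∧ ∀ ε, 0 < ε → ε < ε₁ → P ε := by
  obtain ⟨ε₁, hε₁, hs⟩ := mem_nhdsGT_iff_exists_Ioo_subset.1 h
  exact ⟨ε₁, hε₁, fun ε h0 h1 => hs ⟨h0, h1⟩⟩

/-- The difference `exp z - exp x = exp x (exp X - 1)` has norm at most `4‖X‖`, and the bi-Lipschitz
bound for `exp` doubles this. The bound is linear in `X` alone, so a perturbation of size `ε e^{-T}`
moves the coordinate `x` by that order only. -/
theorem exists_expGL_mul_expGL (H : ClosedSubgroup (GL (Fin n) ℝ)) : ∃ δ : ℝ, 0 < δ ∧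
    ∀ x ∈ lieSubspace H, ∀ X ∈ lieSubspace H, ‖x‖ ≤ δ → ‖X‖ ≤ δ →
      ∃ z ∈ lieSubspace H, expGL z = expGL x * expGL X ∧ ‖z - x‖ ≤ 8 * ‖X‖ := by
  obtain ⟨δ₁, hδ₁, C, hC, h⟩ := exists_eq_prod_expGL H [()] 1
  obtain ⟨δ₂, hδ₂, h₂⟩ := exists_norm_expGL_sub_one_le n
  obtain ⟨δ₃, hδ₃, h₃⟩ := exists_norm_sub_le_expGL n
  obtain ⟨δ, ⟨⟨⟨⟨hle₁, hle₂⟩, hle₃⟩, hle₄⟩, hle₅⟩, hδ⟩ :=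
    ((((((eventually_mul_le 6 hδ₁).and (eventually_mul_le 1 hδ₂)).and
      (eventually_mul_le 1 hδ₃)).and (eventually_mul_le (6 * C) hδ₃)).and
      (eventually_mul_le 2 one_pos)).and self_mem_nhdsWithin).exists
  rw [one_mul] at hle₂ hle₃
  refine ⟨δ, hδ, fun x hx X hX hxδ hXδ => ?_⟩
  have e1 := h₂ x (hxδ.trans hle₂)
  have e2 := h₂ X (hXδ.trans hle₂)
  have hk : ‖((expGL x * expGL X : GL (Fin n) ℝ) : RMat n) - 1‖ ≤ 6 * δ := by
    have := norm_mul_sub_one_le e1 e2 (by linarith)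
    linarith
  obtain ⟨z, hz, hzb, hkz⟩ := h (fun _ => LinearMap.id) (fun _ u => by simp) (fun _ u hu => hu)
    (fun u _ => by simp) (expGL x * expGL X) (mul_mem (expGL_mem hx) (expGL_mem hX))
    (hk.trans hle₁)
  have hkz' : expGL x * expGL X = expGL z := by simpa using hkz
  refine ⟨z, hz, hkz'.symm, ?_⟩
  have h5 := (h₃ z x (hzb.trans (by
    calc C * _ ≤ C * (6 * δ) := by gcongr
      _ ≤ δ₃ := by linarith)) (hxδ.trans hle₃)).1
  have h6 : (expGL z : RMat n) - (expGL x : RMat n) =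
      ((expGL x : RMat n) - 1) * ((expGL X : RMat n) - 1) + ((expGL X : RMat n) - 1) := by
    have := congrArg Units.val hkz'
    rw [Units.val_mul] at this
    rw [← this]; noncomm_ring
  rw [h6] at h5
  have h7 : ‖((expGL x : RMat n) - 1) * ((expGL X : RMat n) - 1)‖ ≤ 1 * (2 * ‖X‖) :=
    (norm_mul_le _ _).trans (by gcongr; linarith)
  linarith [norm_add_le (((expGL x : RMat n) - 1) * ((expGL X : RMat n) - 1)) ((expGL X : RMat n) - 1)]

end NearOne

/-! ### Coordinates in a flow box -/

namespace MetricData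

open scoped Matrix.Norms.Operator

variable {n : ℕ} {G : ClosedSubgroup (GL (Fin n) ℝ)} {D : CartanData G} (R : MetricData D)

theorem mem_flowBox {g₀ g : GL (Fin n) ℝ} {ε : ℝ} : g ∈ R.flowBox g₀ ε ↔
    ∃ q, (∃ x : lieAlg D.Np, R.normNp x < ε ∧ ∃ h ∈ D.N, q = expGL (x : RMat n) * h) ∧
      (∃ y : lieAlg D.N, R.normN y < ε ∧ ∃ p ∈ D.Pp, q = expGL (y : RMat n) * p) ∧
      ∃ m ∈ R.Mball ε, ∃ a ∈ R.Aball ε, g = g₀ * q * m * a := by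
  constructor
  · rintro ⟨_, ⟨_, ⟨_, rfl, q, ⟨⟨_, ⟨x, hx, rfl⟩, h, hh, rfl⟩,
      ⟨_, ⟨_, ⟨_, ⟨y, hy, rfl⟩, h', hh', rfl⟩, _, ⟨w, rfl⟩, rfl⟩, m', hm', hq⟩⟩, rfl⟩, m, hm, rfl⟩,
      a, ha, rfl⟩
    refine ⟨_, ⟨x, hx, h, hh, rfl⟩, ⟨y, hy, h' * (D.expA w * m'),
      ⟨h', hh', _, ⟨w, m', hm', rfl⟩, rfl⟩, ?_⟩, m, hm, a, ha, rfl⟩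
    rw [← mul_assoc, ← mul_assoc]
    exact hq.symm
  · rintro ⟨q, ⟨x, hx, h, hh, rfl⟩, ⟨y, hy, _, ⟨h', hh', _, ⟨w, m', hm', rfl⟩, rfl⟩, hq⟩,
      m, hm, a, ha, rfl⟩
    refine Set.mul_mem_mul (Set.mul_mem_mul (Set.mul_mem_mul rfl ⟨?_, ?_⟩) hm) ha
    · exact Set.mul_mem_mul ⟨x, hx, rfl⟩ hh
    · rw [hq, ← mul_assoc, ← mul_assoc]
      exact Set.mul_mem_mul (Set.mul_mem_mul (Set.mul_mem_mul ⟨y, hy, rfl⟩ hh') ⟨w, rfl⟩) hm'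

/-- The coordinates of an element of a small flow box are small. -/
theorem exists_flowBox_bound : ∃ ε₁ : ℝ, 0 < ε₁ ∧ ∃ C : ℝ, 0 < C ∧ ∀ ε : ℝ, 0 < ε → ε < ε₁ →
    ∀ g₀ g, g ∈ R.flowBox g₀ ε → ∃ (x : lieAlg D.Np) (y : lieAlg D.N), R.normNp x < ε ∧
      R.normN y < ε ∧ ∃ h ∈ D.N, ∃ p ∈ D.Pp, ∃ m ∈ R.Mball ε, ∃ a ∈ R.Aball ε,
      g = g₀ * expGL (x : RMat n) * (h * m * a) ∧ g = g₀ * expGL (y : RMat n) * p ∧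
      ‖(x : RMat n)‖ ≤ C * ε ∧ ‖(y : RMat n)‖ ≤ C * ε ∧
      ‖((h * m * a : GL (Fin n) ℝ) : RMat n) - 1‖ ≤ C * ε ∧ ‖(p : RMat n) - 1‖ ≤ C * ε ∧
      ‖((g₀⁻¹ * g : GL (Fin n) ℝ) : RMat n) - 1‖ ≤ C * ε := by
  obtain ⟨E⟩ := D.nonempty_rootBasis
  obtain ⟨c₁, hc₁, hx₁⟩ := R.exists_normNp_le
  obtain ⟨c₂, hc₂, hx₂⟩ := R.exists_normN_le
  obtain ⟨c₃, hc₃, hd⟩ := R.exists_norm_sub_one_le_of_riemDist_lt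
  obtain ⟨δ₁, hδ₁, hexp⟩ := exists_norm_expGL_sub_one_le n
  obtain ⟨δ₂, hδ₂, c₄, hc₄, hdec⟩ := E.exists_decomp_N
  set β := c₁ + c₂ + c₃ with hβ
  -- `κ ε` will bound `‖h - 1‖`: the element `h p⁻¹` is within `12 β ε` of `1`, `exists_decomp_N`
  -- multiplies this by `c₄`, and `exp` by `2`.
  set κ := 24 * c₄ * β with hκ
  have hβ0 : 0 < β := by positivity
  have hκ0 : 0 < κ := by positivity
  obtain ⟨ε₁, hε₁, hsmall⟩ := exists_pos_forall_lt_of_eventually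
    (((((eventually_mul_le β hδ₁).and (eventually_mul_le (12 * β) hδ₂)).and
      (eventually_mul_le (c₄ * (12 * β)) hδ₁)).and
      (eventually_mul_le κ (δ := 1 / 4) (by norm_num))).and
      (eventually_mul_le β (δ := 1 / 24) (by norm_num)))
  refine ⟨ε₁, hε₁, 22 * β + 4 * κ, by positivity, fun ε hε hεε₁ g₀ g hg => ?_⟩
  obtain ⟨⟨⟨⟨s₁, s₂⟩, s₃⟩, s₄⟩, s₅⟩ := hsmall ε hε hεε₁
  obtain ⟨q, ⟨x, hx, h, hh, hqx⟩, ⟨y, hy, p, hp, hqy⟩, m, hm, a, ha, hgq⟩ := R.mem_flowBox.1 hg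
  have hκε : 0 < κ * ε := by positivity
  have hβε : 0 < β * ε := by positivity
  have hxb : ‖(x : RMat n)‖ ≤ β * ε := by
    refine (hx₁ x).2.trans ?_
    have : c₁ ≤ β := by linarith
    have := apply_nonneg R.normNp x
    gcongr
  have hyb : ‖(y : RMat n)‖ ≤ β * ε := by
    refine (hx₂ y).2.trans ?_
    have : c₂ ≤ β := by linarith
    have := apply_nonneg R.normN y
    gcongr
  have hc₃ε : c₃ * ε ≤ β * ε := by
    gcongr
    linarith
  have hmb : ‖(m : RMat n) - 1‖ ≤ β * ε := (hd ε (by linarith) m hm.2).trans hc₃ε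
  have hab : ‖(a : RMat n) - 1‖ ≤ β * ε := (hd ε (by linarith) a ha.2).trans hc₃ε
  have hex : ‖(expGL (x : RMat n) : RMat n) - 1‖ ≤ 2 * (β * ε) :=
    (hexp _ (hxb.trans s₁)).trans (by linarith)
  have hey : ‖(expGL (-(y : RMat n)) : RMat n) - 1‖ ≤ 2 * (β * ε) :=
    (hexp _ (by rw [norm_neg]; exact hyb.trans s₁)).trans (by rw [norm_neg]; linarith)
  -- From `exp x · h = exp y · p` the quotient `h p⁻¹` is close to `1`, although `h` and `p` are not
  -- yet known to be.
  have hz : h * p⁻¹ = (expGL (-(y : RMat n)) * expGL (x : RMat n))⁻¹ := by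
    have e : expGL (x : RMat n) * h = expGL (y : RMat n) * p := hqx.symm.trans hqy
    rw [expGL_neg, _root_.mul_inv_rev, inv_inv, eq_inv_mul_iff_mul_eq, ← mul_assoc, e]
    group
  have hzb : ‖((h * p⁻¹ : GL (Fin n) ℝ) : RMat n) - 1‖ ≤ 12 * (β * ε) := by
    rw [hz]
    have := norm_inv_sub_one_le (norm_mul_sub_one_le hey hex (by linarith)) (by linarith)
    linarith
  have hxG : expGL (x : RMat n) ∈ G := CartanData.mem_of_mem_Np (expGL_mem (H := D.Np) x.2)
  have hyG : expGL (y : RMat n) ∈ G := CartanData.mem_of_mem_N (expGL_mem (H := D.N) y.2)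
  obtain ⟨Y, hY, p', hp', hYp, hYb⟩ := hdec (h * p⁻¹) (by
    rw [hz, expGL_neg]
    exact inv_mem (mul_mem (inv_mem hyG) hxG)) (hzb.trans (by linarith))
  -- Two factorizations of `h p⁻¹` in `N · N⁺AM` coincide because `N ∩ N⁺AM` is trivial. So `h` is
  -- the small element `exp Y`.
  have hhY : h = expGL Y := by
    have := E.eq_one_of_mem_N_of_mem_Pp (g := (expGL Y)⁻¹ * h)
      (mul_mem (inv_mem (expGL_mem hY)) hh) (by
        have e : (expGL Y)⁻¹ * h = p' * p := by
          rw [inv_mul_eq_iff_eq_mul, ← mul_assoc, ← hYp]; group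
        rw [e]
        exact mul_mem hp' hp)
    exact (inv_mul_eq_one.1 this).symm
  have hYb' : ‖Y‖ ≤ c₄ * (12 * (β * ε)) := hYb.trans (by gcongr)
  have hhb : ‖(h : RMat n) - 1‖ ≤ κ * ε := by
    rw [hhY]
    refine (hexp Y (hYb'.trans (by linarith))).trans ?_
    rw [hκ]; linarith
  have hhma : ‖((h * m * a : GL (Fin n) ℝ) : RMat n) - 1‖ ≤ (4 * β + κ) * ε := by
    have := norm_mul_sub_one_le (norm_mul_sub_one_le hhb hmb (by linarith)) hab (by linarith)
    linarith
  have hg₁ : g = g₀ * expGL (x : RMat n) * (h * m * a) := by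
    rw [hgq, hqx]; group
  have hg₂ : g = g₀ * expGL (y : RMat n) * (p * m * a) := by
    rw [hgq, hqy]; group
  have hgb : ‖((g₀⁻¹ * g : GL (Fin n) ℝ) : RMat n) - 1‖ ≤ (10 * β + 2 * κ) * ε := by
    have e : g₀⁻¹ * g = expGL (x : RMat n) * (h * m * a) := by rw [hg₁]; group
    rw [e]
    have := norm_mul_sub_one_le hex hhma (by linarith)
    linarith
  have hpb : ‖((p * m * a : GL (Fin n) ℝ) : RMat n) - 1‖ ≤ (22 * β + 4 * κ) * ε := by
    have e : p * m * a = expGL (-(y : RMat n)) * (g₀⁻¹ * g) := by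
      rw [hg₂, expGL_neg]; group
    rw [e]
    have := norm_mul_sub_one_le hey hgb (by linarith)
    linarith
  obtain ⟨w, rfl⟩ := ha.1
  -- The returned factor in `N⁺AM` absorbs the trailing `m` and `a`.
  refine ⟨x, y, hx, hy, h, hh, p * m * D.expA w, ?_, m, hm, D.expA w, ha, hg₁, hg₂, ?_, ?_, ?_, hpb,
    ?_⟩
  · have hmem : m * D.expA w ∈ D.AMSubgroup :=
      ⟨w, m, hm.1, (CartanData.commute_of_mem_M hm.1 w).eq⟩
    rw [mul_assoc]
    exact mul_mem hp ⟨1, one_mem _, _, hmem, by simp⟩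
  all_goals linarith

end MetricData

/-! ### Conjugation inside `AM` -/

namespace CartanData

open scoped Matrix.Norms.Operator

variable {n : ℕ} {G : ClosedSubgroup (GL (Fin n) ℝ)} {D : CartanData G}

theorem AM_le_Pp {b : GL (Fin n) ℝ} (hb : b ∈ D.AMSubgroup) : b ∈ D.Pp :=
  ⟨1, one_mem _, b, hb, by simp⟩

theorem expA_mem_AM (w : D.𝔞) : D.expA w ∈ D.AMSubgroup :=
  ⟨w, 1, one_mem D.MSubgroup, by simp⟩

theorem mem_AM_of_mem_M {m : GL (Fin n) ℝ} (hm : m ∈ D.M) : m ∈ D.AMSubgroup :=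
  ⟨0, m, hm, by simp [expA_zero]⟩

theorem conj_AM_eq {m : GL (Fin n) ℝ} (hm : m ∈ D.M) (u v : D.𝔞) {Z : RMat n}
    (hZ : D.IsMTangent Z) : (m * D.expA u)⁻¹ * (D.expA v * expGL Z) * (m * D.expA u) =
      D.expA v * expGL (conjL m⁻¹ Z) := by
  have h1 : m⁻¹ * (D.expA v * expGL Z) * m ∈ D.AMSubgroup :=
    mul_mem (mul_mem (inv_mem (mem_AM_of_mem_M hm))
      (mul_mem (expA_mem_AM v) (mem_AM_of_mem_M hZ.expGL_mem))) (mem_AM_of_mem_M hm)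
  have h2 := (commute_of_mem_AM h1 u).eq
  have h3 := (commute_of_mem_M (D.MSubgroup.inv_mem hm) v).eq
  calc _ = (D.expA u)⁻¹ * (m⁻¹ * (D.expA v * expGL Z) * m * D.expA u) := by group
    _ = m⁻¹ * D.expA v * expGL Z * m := by rw [h2]; group
    _ = _ := by rw [h3, expGL_conjL]; group

theorem conj_AM_mul_eq {m k l : GL (Fin n) ℝ} (hm : m ∈ D.M) (hk : k ∈ D.M) (hl : l ∈ D.M)
    (u v w : D.𝔞) :
    (D.expA u * k) * (D.expA w * m) * (D.expA v * l) * (D.expA u * k)⁻¹ =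
      D.expA (w + v) * (k * m * l * k⁻¹) := by
  have hkml : k * m * l * k⁻¹ ∈ D.M :=
    D.MSubgroup.mul_mem (D.MSubgroup.mul_mem (D.MSubgroup.mul_mem hk hm) hl) (D.MSubgroup.inv_mem hk)
  have h1 := (commute_of_mem_M hm v).eq
  have h2 := (commute_of_mem_M hk (w + v)).eq
  have h3 : D.expA (w + v) * (k * m * l * k⁻¹) ∈ D.AMSubgroup := ⟨_, _, hkml, rfl⟩
  have h4 := (commute_of_mem_AM h3 u).eq
  calc _ = D.expA u * (k * (D.expA w * (m * D.expA v) * l) * k⁻¹) * (D.expA u)⁻¹ := by group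
    _ = D.expA u * ((k * D.expA (w + v)) * m * l * k⁻¹) * (D.expA u)⁻¹ := by
        rw [h1, expA_add]; group
    _ = (D.expA u * (D.expA (w + v) * (k * m * l * k⁻¹))) * (D.expA u)⁻¹ := by rw [h2]; group
    _ = _ := by rw [← h4]; group

end CartanData

/-! ### Distances in `A` and `M`, and the closing lemma -/

namespace MetricData

open scoped Matrix.Norms.Operator

variable {n : ℕ} {G : ClosedSubgroup (GL (Fin n) ℝ)} {D : CartanData G} (R : MetricData D)

theorem exists_riemDist_expA_le : ∃ C : ℝ, 0 < C ∧ ∀ w v : D.𝔞,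
    R.riemDist (D.expA (w + v)) (D.expA w) ≤ ENNReal.ofReal (C * ‖D.toMat v‖) := by
  obtain ⟨C, hC, h⟩ := R.exists_riemDist_le
  refine ⟨C, hC, fun w v => ?_⟩
  have := h (D.expA (w + v)) (D.expA_mem _) 0 (Submodule.zero_mem _) 0 (Submodule.zero_mem _)
    (-D.toMat v) (Submodule.neg_mem _ (CartanData.RootBasis.toMat_mem v)) ‖D.toMat v‖
    (fun t => by simp)
  rw [expGL_zero, one_mul, one_mul, expGL_neg] at this
  change R.riemDist _ (D.expA (w + v) * (D.expA v)⁻¹) ≤ _ at this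
  rwa [D.expA_add, mul_inv_cancel_right, ← D.expA_add] at this

theorem exists_riemDist_M_le : ∃ C : ℝ, 0 < C ∧ ∀ m ∈ D.M, ∀ Z Z' : RMat n, D.IsMTangent Z →
    D.IsMTangent Z' → R.riemDist (expGL Z' * m * expGL Z * (expGL Z')⁻¹) m ≤
      ENNReal.ofReal (C * (‖Z‖ + ‖Z'‖)) := by
  obtain ⟨C, hC, h⟩ := R.exists_riemDist_le
  obtain ⟨c, hc, hK⟩ := exists_norm_conjL_le D.K_compact
  refine ⟨C * (c * c + c + 1), by positivity, fun m hm Z Z' hZ hZ' => ?_⟩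
  set μ := expGL Z' * m * expGL Z * (expGL Z')⁻¹ with hμ
  have hμM : μ ∈ D.M := D.MSubgroup.mul_mem (D.MSubgroup.mul_mem
    (D.MSubgroup.mul_mem hZ'.expGL_mem hm) hZ.expGL_mem) (D.MSubgroup.inv_mem hZ'.expGL_mem)
  have hmZ := hZ.conj hm
  have hmZb : ‖conjL m Z‖ ≤ c * ‖Z‖ := hK m hm.1 Z
  -- The curve runs from `μ` to `m`: right multiplication by `exp Z'` and left multiplication by
  -- `exp(-Z')` undo the conjugation, and `exp(-Ad m Z)` removes the factor `exp Z`. Its velocity is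
  -- bounded uniformly because everything acting on the `Z`s lies in the compact group `K`.
  have := h μ (CartanData.mem_of_mem_M hμM) (-conjL m Z) (Submodule.neg_mem _ hmZ.1) (-Z')
    (Submodule.neg_mem _ hZ'.1) Z' hZ'.1 (c * (c * ‖Z‖) + c * ‖Z'‖ + ‖Z'‖) (fun t => by
      have e1 : expGL (t • -Z') ∈ D.M := by
        have := hZ'.2 (-t)
        rwa [neg_smul, ← smul_neg] at this
      have e2 := D.MSubgroup.mul_mem hμM (hZ'.2 t)
      have e3 := D.MSubgroup.inv_mem
        (D.MSubgroup.mul_mem (D.MSubgroup.mul_mem e1 hμM) (hZ'.2 t))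
      have e4 := D.MSubgroup.inv_mem e2
      refine (norm_add₃_le).trans ?_
      gcongr
      · refine (hK _ e3.1 _).trans ?_
        rw [norm_neg]
        gcongr
      · refine (hK _ e4.1 _).trans ?_
        rw [norm_neg])
  have e : expGL (-conjL m Z) * expGL (-Z') * μ * expGL Z' = m := by
    rw [expGL_neg, expGL_neg, expGL_conjL, hμ]; group
  rw [e] at this
  refine this.trans (ENNReal.ofReal_le_ofReal ?_)
  have h1 := norm_nonneg Z
  have h2 := norm_nonneg Z'
  have h3 : c * (c * ‖Z‖) + c * ‖Z'‖ + ‖Z'‖ ≤ (c * c + c + 1) * (‖Z‖ + ‖Z'‖) := by nlinarith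
  calc _ ≤ C * ((c * c + c + 1) * (‖Z‖ + ‖Z'‖)) := by gcongr
    _ = _ := by ring

/-- The closing lemma. -/
theorem exists_closing : ∃ ε₀ : ℝ, 0 < ε₀ ∧ ∃ C : ℝ, 0 < C ∧
    ∀ ε : ℝ, 0 < ε → ε < ε₀ → ∀ g₀ ∈ G,
      ∀ g₁ ∈ R.flowBox g₀ ε, ∀ g₂ ∈ R.flowBox g₀ ε, ∀ γ ∈ G,
        ∀ (w : D.𝔞), ∀ m' ∈ D.M, g₁ * D.expA w * m' = γ * g₂ →
          ∀ T : ℝ, (∀ α, D.IsPositiveRoot α → T ≤ α w) → 1 ≤ T →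
            ∃ g ∈ R.flowBox g₀ (ε + C * (ε * Real.exp (-T))), ∃ a ∈ D.A, ∃ m ∈ D.M,
              γ = g * a * m * g⁻¹ ∧
              R.riemDist a (D.expA w) ≤ ENNReal.ofReal (C * ε) ∧
              R.riemDist m m' ≤ ENNReal.ofReal (C * ε) := by
  obtain ⟨E⟩ := D.nonempty_rootBasis
  obtain ⟨ε₁, hε₁, C₁, hC₁, hFB⟩ := R.exists_flowBox_bound
  obtain ⟨δt, hδt, Ct, hCt, htw⟩ := E.exists_twisted_decomp
  obtain ⟨δp, hδp, Cp, hCp, hDp⟩ := E.exists_decomp_Np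
  obtain ⟨δm, hδm, Cm, hCm, hDm⟩ := E.exists_decomp_N
  obtain ⟨δe, hδe, hexp⟩ := exists_norm_expGL_sub_one_le n
  obtain ⟨δa, hδa, hmulp⟩ := exists_expGL_mul_expGL D.Np
  obtain ⟨δb, hδb, hmulm⟩ := exists_expGL_mul_expGL D.N
  obtain ⟨cp, hcp, hnp⟩ := R.exists_normNp_le
  obtain ⟨cn, hcn, hnn⟩ := R.exists_normN_le
  obtain ⟨Ca, hCa, hda⟩ := R.exists_riemDist_expA_le
  obtain ⟨CM, hCM, hdM⟩ := R.exists_riemDist_M_le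
  obtain ⟨cK, hcK, hK⟩ := exists_norm_conjL_le D.K_compact
  -- `‖k - 1‖ ≤ 4 C₁ ε`, and `Ct` is the constant of the twisted decomposition. The recurring `6 L`
  -- is `2` for `exp` times `3` for conjugation by an element near `1`.
  set L := Ct * (4 * C₁) with hL
  have hL0 : 0 < L := by positivity
  obtain ⟨ε₂, hε₂, hsmall⟩ := exists_pos_forall_lt_of_eventually
    ((((((((((eventually_mul_le C₁ (δ := 1 / 8) (by norm_num)).and
      (eventually_mul_le (4 * C₁) hδt)).and (eventually_mul_le L hδe)).and
      (eventually_mul_le (6 * L) hδp)).and (eventually_mul_le (6 * L) hδm)).and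
      (eventually_mul_le L (δ := 1 / 32) (by norm_num))).and (eventually_mul_le C₁ hδa)).and
      (eventually_mul_le (Cp * (6 * L)) hδa)).and (eventually_mul_le C₁ hδb)).and
      (eventually_mul_le (Cm * (6 * L)) hδb))
  -- The four summands of the constant pay for the change of the `N⁺` coordinate, that of the `N`
  -- coordinate, the distance in `A` and the distance in `M`.
  refine ⟨min ε₁ ε₂, lt_min hε₁ hε₂,
    cp * (8 * (Cp * (6 * L))) + cn * (8 * (Cm * (6 * L))) + Ca * L +
      CM * (L + cK * (Cp * (6 * L))), by positivity, ?_⟩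
  intro ε hε hεlt g₀ hg₀ g₁ hg₁ g₂ hg₂ γ hγ w m' hm' heq T hT hT1
  obtain ⟨⟨⟨⟨⟨⟨⟨⟨⟨s₁, s₂⟩, s₃⟩, s₄⟩, s₅⟩, s₆⟩, s₇⟩, s₈⟩, s₉⟩, s₁₀⟩ :=
    hsmall ε hε (hεlt.trans_le (min_le_right _ _))
  have hεε₁ := hεlt.trans_le (min_le_left _ _)
  obtain ⟨x, -, hx, -, h₁, hh₁, -, -, m₁, hm₁, a₁, ha₁, hg₁x, -, hxb, -, hq₁b, -, hg₁b⟩ :=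
    hFB ε hε hεε₁ g₀ g₁ hg₁
  obtain ⟨-, y, -, hy, -, -, p, hp, -, -, -, -, -, hg₂y, -, hyb, -, hpb, hg₂b⟩ :=
    hFB ε hε hεε₁ g₀ g₂ hg₂
  set b := D.expA w * m' with hb
  set k := g₂⁻¹ * g₁ with hk
  have hbAM : b ∈ D.AMSubgroup := ⟨w, m', hm', rfl⟩
  have hγb : γ = g₁ * b * g₂⁻¹ := by
    rw [hb, ← mul_assoc, heq]; group
  have hq₁G : h₁ * m₁ * a₁ ∈ G := by
    obtain ⟨u, rfl⟩ := ha₁.1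
    exact mul_mem (mul_mem (CartanData.mem_of_mem_N hh₁) (CartanData.mem_of_mem_M hm₁.1))
      (D.expA_mem u)
  have hpG : p ∈ G := by
    obtain ⟨h', hh', b', hb', rfl⟩ := hp
    exact mul_mem (CartanData.mem_of_mem_Np hh') (CartanData.mem_of_mem_AM hb')
  have hg₁G : g₁ ∈ G := by
    rw [hg₁x]
    exact mul_mem (mul_mem hg₀ (CartanData.mem_of_mem_Np (expGL_mem (H := D.Np) x.2))) hq₁G
  have hg₂G : g₂ ∈ G := by
    rw [hg₂y]
    exact mul_mem (mul_mem hg₀ (CartanData.mem_of_mem_N (expGL_mem (H := D.N) y.2))) hpG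
  have hkb : ‖(k : RMat n) - 1‖ ≤ 4 * C₁ * ε := by
    have e : k = (g₀⁻¹ * g₂)⁻¹ * (g₀⁻¹ * g₁) := by rw [hk]; group
    rw [e]
    have := norm_mul_sub_one_le (norm_inv_sub_one_le hg₂b (by linarith)) hg₁b (by linarith)
    linarith
  obtain ⟨X, hX, S, hS, v, Z, hZ, hkXS, hXb, hσXb, hSb, hvb, hZb⟩ :=
    htw w T hT1 hT m' hm' k (mul_mem (inv_mem hg₂G) hg₁G) (hkb.trans s₂)
  rw [← hb] at hkXS hσXb
  set η := ε * Real.exp (-T) with hη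
  have hη0 : 0 < η := by positivity
  have hηε : η ≤ ε := mul_le_of_le_one_right hε.le (Real.exp_le_one_iff.2 (by linarith))
  have hLη : L * η ≤ L * ε := by gcongr
  have hbd : ∀ r : ℝ, r ≤ Ct * ‖(k : RMat n) - 1‖ → r ≤ L * ε := fun r hr => hr.trans (by
    rw [hL, mul_assoc]; gcongr)
  have hbd' : ∀ r : ℝ, r ≤ Ct * Real.exp (-T) * ‖(k : RMat n) - 1‖ → r ≤ L * η :=
    fun r hr => hr.trans (by
      calc _ ≤ Ct * Real.exp (-T) * (4 * C₁ * ε) := by gcongr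
        _ = L * η := by rw [hL, hη]; ring)
  replace hXb := hbd _ hXb
  replace hσXb := hbd' _ hσXb
  replace hSb := hbd' _ hSb
  replace hvb := hbd _ hvb
  replace hZb := hbd _ hZb
  -- the `N⁺` coordinate
  have hσX : conjL b X ∈ lieSubspace D.Np :=
    conjL_mem_lieSubspace (fun g hg => CartanData.conj_mem_Np hbAM hg) hX
  set q₁ := h₁ * m₁ * a₁ with hq₁
  have hz₁ : ‖((q₁ * expGL (conjL b X) * q₁⁻¹ : GL (Fin n) ℝ) : RMat n) - 1‖ ≤ 6 * L * η := by
    have h1 := hexp _ ((hσXb.trans hLη).trans s₃)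
    have h2 := norm_conj_sub_one_le (h := expGL (conjL b X)) (hq₁b.trans (by linarith))
    linarith
  -- Moving `exp(σX)` to the left of `q₁` conjugates it by `q₁`. The `N⁺` factor of the result
  -- merges with `exp x`, and its `N`, `A` and `M` factors are passed on to the right.
  obtain ⟨X', hX', Y', hY', w₁, Z₁, hZ₁, hz₁eq, hX'b, hZ₁b⟩ := hDp (q₁ * expGL (conjL b X) * q₁⁻¹)
    (mul_mem (mul_mem hq₁G (CartanData.mem_of_mem_Np (expGL_mem hσX))) (inv_mem hq₁G))
    (hz₁.trans (by linarith))
  replace hX'b : ‖X'‖ ≤ Cp * (6 * L) * η := hX'b.trans (by rw [mul_assoc Cp]; gcongr)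
  replace hZ₁b : ‖Z₁‖ ≤ Cp * (6 * L) * ε := hZ₁b.trans (by
    rw [mul_assoc Cp]
    gcongr
    linarith)
  obtain ⟨x', hx', hx'eq, hx'b⟩ := hmulp x x.2 X' hX' (hxb.trans s₇)
    (hX'b.trans ((mul_le_mul_of_nonneg_left hηε (by positivity)).trans s₈))
  -- the `N` coordinate
  set q₂ := p * expGL X with hq₂
  have hq₂P : q₂ ∈ D.Pp := mul_mem hp ⟨_, expGL_mem hX, 1, one_mem _, by simp⟩
  have hq₂G : q₂ ∈ G := mul_mem hpG (CartanData.mem_of_mem_Np (expGL_mem hX))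
  have hz₂ : ‖((q₂ * expGL S * q₂⁻¹ : GL (Fin n) ℝ) : RMat n) - 1‖ ≤ 6 * L * η := by
    have h1 := hexp _ ((hSb.trans hLη).trans s₃)
    have h3 := hexp _ (hXb.trans s₃)
    have h4 := norm_mul_sub_one_le hpb h3 (by linarith)
    have h2 := norm_conj_sub_one_le (h := expGL S) (h4.trans (by linarith))
    linarith
  obtain ⟨Y₂, hY₂, p₂, hp₂, hz₂eq, hY₂b⟩ := hDm (q₂ * expGL S * q₂⁻¹)
    (mul_mem (mul_mem hq₂G (CartanData.mem_of_mem_N (expGL_mem hS))) (inv_mem hq₂G))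
    (hz₂.trans (by linarith))
  replace hY₂b : ‖Y₂‖ ≤ Cm * (6 * L) * η := hY₂b.trans (by rw [mul_assoc Cm]; gcongr)
  obtain ⟨y', hy', hy'eq, hy'b⟩ := hmulm y y.2 Y₂ hY₂ (hyb.trans s₉)
    (hY₂b.trans ((mul_le_mul_of_nonneg_left hηε (by positivity)).trans s₁₀))
  -- the element `g`
  obtain ⟨u₁, hu₁⟩ := ha₁.1
  set c := D.expA v * expGL Z with hc
  set h := expGL X * expGL S with hh
  set d := D.expA w₁ * expGL Z₁ with hd
  have hcAM : c ∈ D.AMSubgroup := ⟨v, _, hZ.expGL_mem, rfl⟩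
  have hdAM : d ∈ D.AMSubgroup := ⟨w₁, _, hZ₁.expGL_mem, rfl⟩
  have hmaAM : m₁ * a₁ ∈ D.AMSubgroup := by
    rw [← hu₁]
    exact mul_mem (CartanData.mem_AM_of_mem_M hm₁.1) (CartanData.expA_mem_AM u₁)
  set Z₁' := conjL m₁⁻¹ Z₁ with hZ₁'
  have hm₁inv := D.MSubgroup.inv_mem hm₁.1
  have hZ₁'M : D.IsMTangent Z₁' := hZ₁.conj hm₁inv
  set r := D.expA w₁ * expGL Z₁' with hr
  have hdr : (m₁ * a₁)⁻¹ * d * (m₁ * a₁) = r := by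
    rw [← hu₁]
    exact CartanData.conj_AM_eq hm₁.1 u₁ w₁ hZ₁
  have hrAM : r ∈ D.AMSubgroup := ⟨w₁, _, hZ₁'M.expGL_mem, rfl⟩
  -- All the `N` factors, gathered to the left of `m₁ a₁` by conjugations in `AM`, which normalizes
  -- `N`. No bound on `N'` is needed for membership in the box.
  set N' := expGL Y' * (d * h₁ * d⁻¹) * ((d * (m₁ * a₁)) * (b * expGL S * b⁻¹) * (d * (m₁ * a₁))⁻¹)
    with hN'
  have hN'mem : N' ∈ D.N := mul_mem (mul_mem (expGL_mem hY') (CartanData.conj_mem_N hdAM hh₁))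
    (CartanData.conj_mem_N (mul_mem hdAM hmaAM) (CartanData.conj_mem_N hbAM (expGL_mem hS)))
  have hg₂h : g₂ * h = g₀ * (expGL x' * N') * m₁ * a₁ * (r * c⁻¹) := by
    -- The twisted equation rewrites `g₂ h` from the side of `g₁`, where `X` enters only through its
    -- contracted image `σX`.
    have e1 : g₂ * h = g₁ * (b * h * b⁻¹) * c⁻¹ := by
      have : g₁ = g₂ * (h * c * (b * h * b⁻¹)⁻¹) := by rw [← hkXS, hk]; group
      rw [this]; group
    have e2 : q₁ * expGL (conjL b X) = expGL X' * expGL Y' * d * q₁ := by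
      rw [← hz₁eq]; group
    have e3 : b * h * b⁻¹ = expGL (conjL b X) * (b * expGL S * b⁻¹) := by
      rw [expGL_conjL, hh]; group
    calc g₂ * h = g₀ * expGL (x : RMat n) * (q₁ * expGL (conjL b X)) * (b * expGL S * b⁻¹) * c⁻¹ := by
          rw [e1, hg₁x, e3]; group
      _ = _ := by
          rw [e2, hx'eq, ← hdr, hN', hq₁]; group
  -- The conjugator is `g₂ h` without the right factor `r c⁻¹ ∈ AM`; its `M` and `A` factors `m₁`,
  -- `a₁` are those of `g₁`.
  refine ⟨g₀ * (expGL x' * N') * m₁ * a₁, ?_, D.expA (w + v), ⟨_, rfl⟩,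
    expGL Z₁' * m' * expGL Z * (expGL Z₁')⁻¹, ?_, ?_, ?_, ?_⟩
  · have hCη : ∀ c' : ℝ, 0 ≤ c' → c' ≤ cp * (8 * (Cp * (6 * L))) + cn * (8 * (Cm * (6 * L))) →
        c' * η ≤ (cp * (8 * (Cp * (6 * L))) + cn * (8 * (Cm * (6 * L))) + Ca * L +
          CM * (L + cK * (Cp * (6 * L)))) * η := fun c' _ hle => by
      gcongr
      have h1 : 0 ≤ Ca * L := by positivity
      have h2 : 0 ≤ CM * (L + cK * (Cp * (6 * L))) := by positivity
      linarith
    have hεle : ε ≤ ε + (cp * (8 * (Cp * (6 * L))) + cn * (8 * (Cm * (6 * L))) + Ca * L +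
        CM * (L + cK * (Cp * (6 * L)))) * η := le_add_of_nonneg_right (by positivity)
    refine R.mem_flowBox.2 ⟨expGL x' * N', ⟨⟨x', hx'⟩, ?_, N', hN'mem, rfl⟩, ⟨⟨y', hy'⟩, ?_,
      p₂ * q₂ * (r * c⁻¹)⁻¹ * (m₁ * a₁)⁻¹, ?_, ?_⟩,
      m₁, ⟨hm₁.1, hm₁.2.trans_le (ENNReal.ofReal_le_ofReal hεle)⟩,
      a₁, ⟨ha₁.1, ha₁.2.trans_le (ENNReal.ofReal_le_ofReal hεle)⟩, rfl⟩
    · have e : (⟨x', hx'⟩ : lieAlg D.Np) = x + (⟨x', hx'⟩ - x) := by abel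
      have h1 : R.normNp (⟨x', hx'⟩ - x) ≤ cp * (8 * (Cp * (6 * L))) * η := by
        refine (hnp _).1.trans ?_
        change cp * ‖x' - (x : RMat n)‖ ≤ _
        calc _ ≤ cp * (8 * (Cp * (6 * L) * η)) := by gcongr; linarith
          _ = _ := by ring
      have h2 := hCη (cp * (8 * (Cp * (6 * L)))) (by positivity)
        (le_add_of_nonneg_right (by positivity))
      rw [e]
      have h3 := map_add_le_add R.normNp x (⟨x', hx'⟩ - x)
      linarith
    · have e : (⟨y', hy'⟩ : lieAlg D.N) = y + (⟨y', hy'⟩ - y) := by abel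
      have h1 : R.normN (⟨y', hy'⟩ - y) ≤ cn * (8 * (Cm * (6 * L))) * η := by
        refine (hnn _).1.trans ?_
        change cn * ‖y' - (y : RMat n)‖ ≤ _
        calc _ ≤ cn * (8 * (Cm * (6 * L) * η)) := by gcongr; linarith
          _ = _ := by ring
      have h2 := hCη (cn * (8 * (Cm * (6 * L)))) (by positivity)
        (le_add_of_nonneg_left (by positivity))
      rw [e]
      have h3 := map_add_le_add R.normN y (⟨y', hy'⟩ - y)
      linarith
    · exact mul_mem (mul_mem (mul_mem hp₂ hq₂P)
        (inv_mem (CartanData.AM_le_Pp (mul_mem hrAM (inv_mem hcAM)))))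
        (inv_mem (CartanData.AM_le_Pp hmaAM))
    · have e1 : expGL x' * N' = g₀⁻¹ * (g₂ * h) * (r * c⁻¹)⁻¹ * (m₁ * a₁)⁻¹ := by
        rw [hg₂h]; group
      have e2 : q₂ * expGL S = expGL Y₂ * p₂ * q₂ := by
        rw [← hz₂eq]; group
      have e3 : g₂ * h = g₀ * expGL (y : RMat n) * (q₂ * expGL S) := by
        rw [hg₂y, hh, hq₂]; group
      rw [e1, e3, e2, hy'eq]; group
  · exact D.MSubgroup.mul_mem (D.MSubgroup.mul_mem (D.MSubgroup.mul_mem hZ₁'M.expGL_mem hm')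
      hZ.expGL_mem) (D.MSubgroup.inv_mem hZ₁'M.expGL_mem)
  · have e1 : γ = (g₂ * h) * (c * b) * (g₂ * h)⁻¹ := by
      have : g₁ = g₂ * (h * c * (b * h * b⁻¹)⁻¹) := by rw [← hkXS, hk]; group
      rw [hγb, this]; group
    -- Moving `r c⁻¹` into the middle turns `c b` into `r b c r⁻¹`. Its `A` part is `exp(w + v)`
    -- since `A` is central in `AM`, and its `M` part is a conjugate of `m' exp Z`.
    have e2 := CartanData.conj_AM_mul_eq hm' hZ₁'M.expGL_mem hZ.expGL_mem w₁ v w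
    rw [← hr, ← hb, ← hc] at e2
    rw [mul_assoc (g₀ * (expGL x' * N') * m₁ * a₁), ← e2, e1, hg₂h]
    group
  · refine (hda w v).trans (ENNReal.ofReal_le_ofReal ?_)
    calc Ca * ‖D.toMat v‖ ≤ Ca * (L * ε) := by gcongr
      _ = Ca * L * ε := by ring
      _ ≤ _ := by
        gcongr
        have h1 : 0 ≤ cp * (8 * (Cp * (6 * L))) + cn * (8 * (Cm * (6 * L))) := by positivity
        have h2 : 0 ≤ CM * (L + cK * (Cp * (6 * L))) := by positivity
        linarith
  · refine (hdM m' hm' Z Z₁' hZ hZ₁'M).trans (ENNReal.ofReal_le_ofReal ?_)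
    have hZ₁'b : ‖Z₁'‖ ≤ cK * (Cp * (6 * L) * ε) := (hK _ hm₁inv.1 Z₁).trans (by gcongr)
    calc CM * (‖Z‖ + ‖Z₁'‖) ≤ CM * (L * ε + cK * (Cp * (6 * L) * ε)) := by gcongr
      _ = CM * (L + cK * (Cp * (6 * L))) * ε := by ring
      _ ≤ _ := by
        gcongr
        have h1 : 0 ≤ cp * (8 * (Cp * (6 * L))) + cn * (8 * (Cm * (6 * L))) + Ca * L := by
          positivity
        linarith

end MetricData

end

theorem mainTheorem10 (n : ℕ) (G : ClosedSubgroup (GL (Fin n) ℝ))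
    (hG : IsConnectedSemisimpleRealAlgebraic G) :
    ∃ T₀ : ℝ, 0 < T₀ ∧ ∀ (D : CartanData G) (R : MetricData D),
      ∃ ε₀ : ℝ, 0 < ε₀ ∧ ∃ C : ℝ, 0 < C ∧
        ∀ ε : ℝ, 0 < ε → ε < ε₀ → ∀ g₀ ∈ G,
          ∀ g₁ ∈ R.flowBox g₀ ε, ∀ g₂ ∈ R.flowBox g₀ ε, ∀ γ ∈ G,
            ∀ (w : D.𝔞), ∀ m' ∈ D.M, g₁ * D.expA w * m' = γ * g₂ →
              ∀ T : ℝ, IsLeast {r : ℝ | ∃ α, D.IsPositiveRoot α ∧ r = α w} T → T₀ ≤ T →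
                ∃ g ∈ R.flowBox g₀ (ε + C * (ε * Real.exp (-T))), ∃ a ∈ D.A, ∃ m ∈ D.M,
                  γ = g * a * m * g⁻¹ ∧
                  R.riemDist a (D.expA w) ≤ ENNReal.ofReal (C * ε) ∧
                  R.riemDist m m' ≤ ENNReal.ofReal (C * ε) := by
  -- `T₀ = 1` serves for every group; it only ensures `e^{-T} ≤ 1/2`.
  refine ⟨1, one_pos, fun D R => ?_⟩
  obtain ⟨ε₀, hε₀, C, hC, h⟩ := R.exists_closing
  refine ⟨ε₀, hε₀, C, hC, fun ε hε hεlt g₀ hg₀ g₁ hg₁ g₂ hg₂ γ hγ w m' hm' heq T hT hT1 => ?_⟩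
  exact h ε hε hεlt g₀ hg₀ g₁ hg₁ g₂ hg₂ γ hγ w m' hm' heq T (fun α hα => hT.2 ⟨α, hα, rfl⟩) hT1
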